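/- Let $n\ge 1$, let $\Omega\subset\mathbb C^n$ be a bounded domain (a nonempty connected open set) with $C^2$ boundary, let $0<p<\infty$, and put $q=p\left(1+\frac1n\right)$. Let $\delta(z)$ denote the Euclidean distance from $z\in\Omega$ to $\partial\Omega$. For a holomorphic function $f$ on $\Omega$ put $$\|f\|_{A^q(\Omega)}=\Big(\int_\Omega |f|^q\Big)^{1/q},\qquad \|f\|_{H^p(\Omega)}=\Big(\sup_{\varepsilon>0}\int_{\{z\in\Omega:\,\delta(z)=\varepsilon\}}|f|^p\,dS_\varepsilon\Big)^{1/p},$$ where the first integral is with respect to Lebesgue measure and $dS_\varepsilon$ is the surface measure ($(2n-1)$-dimensional Hausdorff measure). Let $A^q(\Omega)$, respectively $H^p(\Omega)$, be the set of holomorphic functions $f$ on $\Omega$ with $\|f\|_{A^q(\Omega)}<\infty$, respectively $\|f\|_{H^p(\Omega)}<\infty$. Then there is a constant $C<\infty$, depending only on $n$, $\Omega$ and $p$, such that every $f\in H^p(\Omega)$ belongs to $A^q(\Omega)$ and $$\|f\|_{A^q(\Omega)}\le C\,\|f\|_{H^p(\Omega)}.$$ In particular, there is a constant $C'<\infty$,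 depending only on $n$, $\Omega$ and $p$, such that for all $z\in\Omega$ $$S_p(z)^{1/p}\le C'\,K_q(z)^{1/q},$$ where $$S_p(z)=\sup\{|f(z)|^p:\ f\in H^p(\Omega),\ \|f\|_{H^p(\Omega)}\le 1\}$$ is the $p$-Szegő kernel and $$K_q(z)=\Big(\inf\{\|f\|_{A^q(\Omega)}:\ f\in A^q(\Omega),\ f(z)=1\}\Big)^{-q}$$ is the $q$-Bergman kernel. -/

import Mathlib

open MeasureTheory Topology
open scoped ENNReal NNReal

noncomputable section

/-- The space `ℂⁿ` with its Euclidean norm. Its `volume` is Lebesgue measure on `ℝ²ⁿ`. -/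
abbrev CSpace (n : ℕ) : Type := EuclideanSpace ℂ (Fin n)

/-- A bounded domain: a bounded, nonempty, connected open subset of `ℂⁿ`. -/
structure IsBoundedDomain {n : ℕ} (Ω : Set (CSpace n)) : Prop where
  isOpen : IsOpen Ω
  isConnected : IsConnected Ω
  isBounded : Bornology.IsBounded Ω

/-- `Ω` has `C²` boundary: near every boundary point, `Ω` is the sublevel set `{ρ < 0}` of a real
function `ρ` of (real) class `C²` with nonvanishing real differential. -/
def HasC2Boundary {n : ℕ} (Ω : Set (CSpace n)) : Prop :=
  ∀ x ∈ frontier Ω, ∃ ρ : CSpace n → ℝ,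
    ContDiffAt ℝ 2 ρ x ∧ fderiv ℝ ρ x ≠ 0 ∧ ∀ᶠ z in 𝓝 x, (z ∈ Ω ↔ ρ z < 0)

/-- The boundary distance `δ(z)`. -/
def boundaryDist {n : ℕ} (Ω : Set (CSpace n)) (z : CSpace n) : ℝ :=
  Metric.infDist z (frontier Ω)

/-- The `p`-Bergman norm `(∫_Ω |f|^p)^{1/p}`, with values in `[0, ∞]`. -/
def bergmanNorm {n : ℕ} (Ω : Set (CSpace n)) (p : ℝ) (f : CSpace n → ℂ) : ℝ≥0∞ :=
  (∫⁻ z in Ω, ‖f z‖ₑ ^ p) ^ (1 / p)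

/-- The `p`-Bergman space `A^p(Ω)`. Its elements are holomorphic on `Ω`; their values
outside `Ω` are irrelevant. -/
def bergmanSpace {n : ℕ} (Ω : Set (CSpace n)) (p : ℝ) : Set (CSpace n → ℂ) :=
  {f | DifferentiableOn ℂ f Ω ∧ bergmanNorm Ω p f < ⊤}

/-- `m_p(z) = inf {‖f‖_p : f ∈ A^p(Ω), f(z) = 1}`. -/
def bergmanMin {n : ℕ} (Ω : Set (CSpace n)) (p : ℝ) (z : CSpace n) : ℝ≥0∞ :=
  ⨅ (f : CSpace n → ℂ) (_ : f ∈ bergmanSpace Ω p) (_ : f z = 1), bergmanNorm Ω p f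

/-- The `p`-Bergman kernel `K_p(z) = m_p(z)^{-p}`. -/
def bergmanKernel {n : ℕ} (Ω : Set (CSpace n)) (p : ℝ) (z : CSpace n) : ℝ≥0∞ :=
  bergmanMin Ω p z ^ (-p)

/-- The Hardy norm `(sup_{ε > 0} ∫_{δ = ε} |f|^p dS_ε)^{1/p}`, with values in `[0, ∞]`. The level
set is taken in `Ω`, and `dS_ε` is its `(2n-1)`-dimensional surface measure, that is, Hausdorff
measure in the Euclidean normalization. -/
def hardyNorm {n : ℕ} (Ω : Set (CSpace n)) (p : ℝ) (f : CSpace n → ℂ) : ℝ≥0∞ :=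
  (⨆ (ε : ℝ) (_ : 0 < ε),
    ∫⁻ z in {z | z ∈ Ω ∧ boundaryDist Ω z = ε}, ‖f z‖ₑ ^ p ∂μHE[2 * n - 1]) ^ (1 / p)

/-- The Hardy space `H^p(Ω)`. -/
def hardySpace {n : ℕ} (Ω : Set (CSpace n)) (p : ℝ) : Set (CSpace n → ℂ) :=
  {f | DifferentiableOn ℂ f Ω ∧ hardyNorm Ω p f < ⊤}

/-- The `p`-Szegő kernel `S_p(z) = sup {|f(z)|^p : f ∈ H^p(Ω), ‖f‖_{H^p} ≤ 1}`. -/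
def szegoKernel {n : ℕ} (Ω : Set (CSpace n)) (p : ℝ) (z : CSpace n) : ℝ≥0∞ :=
  ⨆ (f : CSpace n → ℂ) (_ : f ∈ hardySpace Ω p) (_ : hardyNorm Ω p f ≤ 1), ‖f z‖ₑ ^ p

end

/-! Apart from the maximum principle, the only property of f that matters is that the powers |f|^s,
and hence their truncations (|f|^s - l)_+, have the sub-mean value property on complex discs. Let τ
be a C² defining function, positive in Ω, and let w be such a truncation.

Three estimates carry the argument. Averaging w over a polydisc with radius about τ(z) in the
complex normal direction and about √τ(z) in the other n-1 directions, whose volume is about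
τ(z)^(n+1), bounds τ(z)^(n+1) w(z) by the mass of w in the shell {0 < τ < 2τ(z)}
(`exists_pointwise_bound`). Testing subharmonicity against functions of τ shows that, for thin
shells {0 < τ < b}, the mass per unit thickness is at most a constant times that of any thinner
shell (`exists_shellMass_comparison`). A coarea-type inequality bounds the integral of |f|^p over
such a shell by b times the Hardy supremum A (`exists_shell_le_slices`).

If B bounds the mass of w per unit thickness, then τ^n w ≲ B. So {w > l} lies in a shell of
thickness about (B/l)^(1/n), and Chebyshev's inequality there gives volume ≲ (B/l)^(1+1/n)
(`exists_weak_type_bound`).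

Applied to a single function this is only a weak-type bound. The strong bound comes from truncating
at every level: put v = |f|^(p/2), w_l = (v - l)_+, and let B(l) be the lower limit of the mass of
w_l per unit thickness as the shell shrinks to the boundary. Both ∫ (v - l)_+ dl and l (v - l)_+ are
at most v² = |f|^p, so ∫ B(l) dl ≲ A and l B(l) ≲ A. With s = 2 + 2/n, the product l^(s-1)
(B/l)^(1+1/n) equals (l B)^(1/n) B ≲ A^(1/n) B(l), which integrates to ≲ A^(1+1/n). Since v^s =
|f|^q, the layer-cake formula finishes the norm inequality. For the kernels, f/f(z) competes in the
Bergman extremal problem. -/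

/-! ### Sub-mean value property of powers of holomorphic functions -/

/-- Jensen's formula handles log|F|. Convexity of the exponential passes to powers: with a = |F(0)|,
the inequality e^x ≥ 1 + x gives |F|^s ≥ a^s (1 + s (log|F| - log a)), and the average of the right
side is at least a^s. -/
theorem norm_rpow_le_circleAverage {F : ℂ → ℂ} {s : ℝ} (hs : 0 < s)
    (hF : AnalyticOnNhd ℂ F (Metric.closedBall 0 1)) :
    ‖F 0‖ ^ s ≤ Real.circleAverage (fun ζ => ‖F ζ‖ ^ s) 0 1 := by
  by_cases h0 : F 0 = 0
  · rw [h0, norm_zero, Real.zero_rpow hs.ne']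
    exact Real.circleAverage_nonneg_of_nonneg fun x _ => by positivity
  have habs : |(1 : ℝ)| = 1 := abs_one
  have ha : 0 < ‖F 0‖ := norm_pos_iff.2 h0
  have hlogI : CircleIntegrable (fun ζ => Real.log ‖F ζ‖) 0 1 := by
    apply MeromorphicOn.circleIntegrable_log_norm
    rw [habs]
    exact (hF.mono Metric.sphere_subset_closedBall).meromorphicOn
  have hpowI : CircleIntegrable (fun ζ => ‖F ζ‖ ^ s) 0 1 := by
    apply ContinuousOn.circleIntegrable zero_le_one
    exact ((hF.continuousOn.mono Metric.sphere_subset_closedBall).norm).rpow_const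
      fun x _ => Or.inr hs.le
  have hlog : Real.log ‖F 0‖ ≤ Real.circleAverage (fun ζ => Real.log ‖F ζ‖) 0 1 := by
    have hF' : AnalyticOnNhd ℂ F (Metric.closedBall 0 |(1 : ℝ)|) := by rwa [habs]
    rw [hF'.circleAverage_log_norm one_ne_zero h0, le_add_iff_nonneg_left]
    refine finsum_nonneg fun u => ?_
    by_cases hu : u ∈ Metric.closedBall (0 : ℂ) |(1 : ℝ)|
    · refine mul_nonneg (mod_cast (MeromorphicOn.AnalyticOnNhd.divisor_nonneg hF') u) ?_
      rw [habs] at hu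
      by_cases hu0 : u = 0
      · simp [hu0]
      · refine Real.log_nonneg ?_
        rw [one_mul, zero_sub, norm_neg]
        exact (one_le_inv₀ (norm_pos_iff.2 hu0)).2 (by simpa using hu)
    · simp only [hu, not_false_eq_true, Function.locallyFinsuppWithin.apply_eq_zero_of_notMem,
            Int.cast_zero, zero_mul, le_refl]
  set a := ‖F 0‖ with ha_def
  let u : ℂ → ℝ := fun ζ => ‖F ζ‖ ^ s - a ^ s * (1 + s * (Real.log ‖F ζ‖ - Real.log a))
  have hu : 0 ≤ Real.circleAverage u 0 1 := by
    -- The pointwise inequality can fail at zeros of F, where `Real.log 0 = 0`. These form a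
    -- discrete set, invisible to the circle average, so u may be replaced by its positive part.
    have hcd : (fun ζ => max (u ζ) 0) =ᶠ[Filter.codiscreteWithin (Metric.sphere (0 : ℂ) |(1:ℝ)|)] u := by
      have h1 : F ⁻¹' {0}ᶜ ∈ Filter.codiscreteWithin (Metric.closedBall (0 : ℂ) 1) :=
        hF.preimage_zero_mem_codiscreteWithin h0 (by simp)
          ((convex_closedBall (0:ℂ) 1).isConnected (by simp))
      rw [habs]
      filter_upwards [Filter.codiscreteWithin_mono Metric.sphere_subset_closedBall h1] with ζ hζ
      have hpos : 0 < ‖F ζ‖ := norm_pos_iff.2 hζ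
      refine max_eq_left ?_
      have h2 := Real.add_one_le_exp (s * (Real.log ‖F ζ‖ - Real.log a))
      have h3 : ‖F ζ‖ ^ s = a ^ s * Real.exp (s * (Real.log ‖F ζ‖ - Real.log a)) := by
        rw [Real.rpow_def_of_pos hpos, Real.rpow_def_of_pos ha, ← Real.exp_add]
        ring_nf
      simp only [u]
      rw [h3, ← mul_sub]
      have : 0 < a ^ s := by positivity
      apply mul_nonneg this.le
      linarith
    rw [← Real.circleAverage_congr_codiscreteWithin hcd one_ne_zero]
    exact Real.circleAverage_nonneg_of_nonneg fun x _ => le_max_right _ _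
  have hexp : Real.circleAverage u 0 1 = Real.circleAverage (fun ζ => ‖F ζ‖ ^ s) 0 1
      - (a ^ s * (1 - s * Real.log a) +
        (a ^ s * s) * Real.circleAverage (fun ζ => Real.log ‖F ζ‖) 0 1) := by
    have e : u = fun ζ => ‖F ζ‖ ^ s - ((a ^ s * (1 - s * Real.log a)) +
        (a ^ s * s) • Real.log ‖F ζ‖) := by
      ext ζ; simp only [u, smul_eq_mul]; ring
    rw [e, Real.circleAverage_fun_sub hpowI, Real.circleAverage_fun_add, Real.circleAverage_const,
      Real.circleAverage_fun_smul, smul_eq_mul]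
    · exact circleIntegrable_const _ _ _
    · exact hlogI.const_smul
    · exact (circleIntegrable_const _ _ _).add hlogI.const_smul
  rw [hexp] at hu
  have hpos : 0 < a ^ s * s := by positivity
  nlinarith [mul_le_mul_of_nonneg_left hlog hpos.le]

/-- Continuous nonnegative functions on `Ω` with the sub-mean value property on affine complex
discs contained in `Ω`. -/
structure DiscSubmean {n : ℕ} (Ω : Set (CSpace n)) (w : CSpace n → ℝ) : Prop where
  continuousOn : ContinuousOn w Ω
  nonneg : ∀ z, 0 ≤ w z
  le_circleAverage : ∀ z ξ, (∀ ζ : ℂ, ‖ζ‖ ≤ 1 → z + ζ • ξ ∈ Ω) →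
    w z ≤ Real.circleAverage (fun ζ => w (z + ζ • ξ)) 0 1

theorem continuousOn_disc {n : ℕ} {Ω : Set (CSpace n)} {w : CSpace n → ℝ}
    (hw : ContinuousOn w Ω) {z ξ : CSpace n} (h : ∀ ζ : ℂ, ‖ζ‖ ≤ 1 → z + ζ • ξ ∈ Ω) :
    ContinuousOn (fun ζ : ℂ => w (z + ζ • ξ)) (Metric.sphere 0 1) :=
  hw.comp (by fun_prop) fun ζ hζ => h ζ (by simpa using (mem_sphere_zero_iff_norm.1 hζ).le)

theorem discSubmean_norm_rpow_sub {n : ℕ} {Ω : Set (CSpace n)} (hΩ : IsOpen Ω)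
    {f : CSpace n → ℂ} (hf : DifferentiableOn ℂ f Ω) {s : ℝ} (hs : 0 < s) (l : ℝ) :
    DiscSubmean Ω (fun z => max (‖f z‖ ^ s - l) 0) where
  continuousOn := (((hf.continuousOn.norm).rpow_const fun x _ => Or.inr hs.le).sub
    continuousOn_const).sup continuousOn_const
  nonneg z := le_max_right _ _
  le_circleAverage z ξ h := by
    have hc := continuousOn_disc (((hf.continuousOn.norm).rpow_const
      fun x _ => Or.inr hs.le : ContinuousOn (fun z => ‖f z‖ ^ s) Ω)) h
    have hI := hc.circleIntegrable zero_le_one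
    have hc' := continuousOn_disc ((((hf.continuousOn.norm).rpow_const fun x _ => Or.inr hs.le).sub
      continuousOn_const).sup continuousOn_const :
        ContinuousOn (fun z => max (‖f z‖ ^ s - l) 0) Ω) h
    have hI' := hc'.circleIntegrable zero_le_one
    have hF : AnalyticOnNhd ℂ (fun ζ : ℂ => f (z + ζ • ξ)) (Metric.closedBall 0 1) := by
      have ho : IsOpen ((fun ζ : ℂ => z + ζ • ξ) ⁻¹' Ω) := hΩ.preimage (by fun_prop)
      have hd : DifferentiableOn ℂ (fun ζ : ℂ => f (z + ζ • ξ)) ((fun ζ : ℂ => z + ζ • ξ) ⁻¹' Ω) :=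
        hf.comp (by fun_prop) fun ζ hζ => hζ
      exact (hd.analyticOnNhd ho).mono fun ζ hζ => h ζ (by simpa using hζ)
    have key := norm_rpow_le_circleAverage hs hF
    simp only [zero_smul, add_zero] at key
    refine max_le ?_ (Real.circleAverage_nonneg_of_nonneg fun x _ => le_max_right _ _)
    calc ‖f z‖ ^ s - l ≤ Real.circleAverage (fun ζ => ‖f (z + ζ • ξ)‖ ^ s) 0 1 - l := by linarith
      _ = Real.circleAverage (fun ζ => ‖f (z + ζ • ξ)‖ ^ s - l) 0 1 := by
        rw [Real.circleAverage_fun_sub hI (circleIntegrable_const _ _ _), Real.circleAverage_const]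
      _ ≤ _ := Real.circleAverage_mono (hI.sub (circleIntegrable_const _ _ _)) hI'
        fun x _ => le_max_left _ _

/-! ### Averages over balanced sets -/

/-- Multiplication by `e^{iθ}` as a real linear isometry. -/
noncomputable def phaseRotation (n : ℕ) (θ : ℝ) : CSpace n ≃ₗᵢ[ℝ] CSpace n where
  toLinearEquiv := DistribMulAction.toLinearEquiv ℝ (CSpace n)
    (Units.mk0 (Complex.exp (θ * Complex.I)) (Complex.exp_ne_zero _))
  norm_map' x := by
    simp [DistribMulAction.toLinearEquiv, Units.smul_def, norm_smul, Complex.norm_exp_ofReal_mul_I]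

theorem phaseRotation_apply (n : ℕ) (θ : ℝ) (x : CSpace n) :
    phaseRotation n θ x = Complex.exp (θ * Complex.I) • x := rfl

theorem DiscSubmean.mul_le_lintegral_circle {n : ℕ} {Ω : Set (CSpace n)} {w : CSpace n → ℝ}
    (hw : DiscSubmean Ω w) {z ξ : CSpace n} (h : ∀ ζ : ℂ, ‖ζ‖ ≤ 1 → z + ζ • ξ ∈ Ω) :
    ENNReal.ofReal (w z) * ENNReal.ofReal (2 * Real.pi) ≤
      ∫⁻ θ in Set.Ioc 0 (2 * Real.pi), ENNReal.ofReal (w (z + Complex.exp (θ * Complex.I) • ξ)) := by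
  have hI : CircleIntegrable (fun ζ => w (z + ζ • ξ)) 0 1 :=
    (continuousOn_disc hw.continuousOn h).circleIntegrable zero_le_one
  have h1 := hw.le_circleAverage z ξ h
  rw [Real.circleAverage_def, intervalIntegral.integral_of_le (by positivity), smul_eq_mul,
    inv_mul_eq_div, le_div_iff₀ (by positivity)] at h1
  rw [← ENNReal.ofReal_mul (hw.nonneg z)]
  have hI' : IntegrableOn (fun θ : ℝ => w (z + circleMap 0 1 θ • ξ)) (Set.Ioc 0 (2 * Real.pi)) :=
    (intervalIntegrable_iff_integrableOn_Ioc_of_le (by positivity)).1 hI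
  rw [show (∫⁻ θ in Set.Ioc 0 (2 * Real.pi),
      ENNReal.ofReal (w (z + Complex.exp (θ * Complex.I) • ξ))) =
      ENNReal.ofReal (∫ θ in Set.Ioc 0 (2 * Real.pi), w (z + circleMap 0 1 θ • ξ)) by
    rw [ofReal_integral_eq_lintegral_ofReal hI' (ae_of_all _ fun θ => hw.nonneg _)]
    simp [circleMap]]
  exact ENNReal.ofReal_le_ofReal h1

/-- Integrate the circle inequality over all ξ in D and exchange the integrals: each rotation by
e^{iθ} preserves both D and Lebesgue measure, so the θ-average disappears. -/
theorem DiscSubmean.mul_volume_le {n : ℕ} {Ω : Set (CSpace n)} (hΩ : IsOpen Ω) {w : CSpace n → ℝ}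
    (hw : DiscSubmean Ω w) {z : CSpace n} {D : Set (CSpace n)} (hD : MeasurableSet D)
    (hbal : ∀ ζ : ℂ, ‖ζ‖ ≤ 1 → ∀ ξ ∈ D, ζ • ξ ∈ D) (hzD : ∀ ξ ∈ D, z + ξ ∈ Ω) :
    ENNReal.ofReal (w z) * volume D ≤ ∫⁻ ξ in D, ENNReal.ofReal (w (z + ξ)) := by
  set g : CSpace n → ℝ≥0∞ := Set.indicator Ω (fun x => ENNReal.ofReal (w x)) with hg
  have hgm : Measurable g := by
    have : Measurable (Ω.indicator w) := by
      classical
      rw [← Set.piecewise_eq_indicator]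
      exact hw.continuousOn.measurable_piecewise continuousOn_const hΩ.measurableSet
    have e : g = fun x => ENNReal.ofReal (Ω.indicator w x) := by
      ext x
      by_cases hx : x ∈ Ω <;> simp [hg, hx]
    rw [e]
    exact this.ennreal_ofReal
  have hgD : ∀ ξ ∈ D, g (z + ξ) = ENNReal.ofReal (w (z + ξ)) := fun ξ hξ => by
    simp [hg, hzD ξ hξ]
  have hrot : ∀ θ : ℝ, ∀ ξ ∈ D, Complex.exp (θ * Complex.I) • ξ ∈ D := fun θ ξ hξ =>
    hbal _ (Complex.norm_exp_ofReal_mul_I θ).le ξ hξ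
  have hpi : ENNReal.ofReal (2 * Real.pi) ≠ 0 := by simpa using Real.pi_pos
  rw [← ENNReal.mul_le_mul_iff_right hpi ENNReal.ofReal_ne_top]
  calc ENNReal.ofReal (2 * Real.pi) * (ENNReal.ofReal (w z) * volume D)
      = ∫⁻ ξ in D, ENNReal.ofReal (w z) * ENNReal.ofReal (2 * Real.pi) := by
        rw [lintegral_const, Measure.restrict_apply_univ]; ring
    _ ≤ ∫⁻ ξ in D, ∫⁻ θ in Set.Ioc 0 (2 * Real.pi), g (z + Complex.exp (θ * Complex.I) • ξ) := by
        refine setLIntegral_mono' hD fun ξ hξ => ?_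
        refine (hw.mul_le_lintegral_circle fun ζ hζ => hzD _ (hbal ζ hζ ξ hξ)).trans_eq ?_
        exact lintegral_congr fun θ => (hgD _ (hrot θ ξ hξ)).symm
    _ = ∫⁻ θ in Set.Ioc 0 (2 * Real.pi), ∫⁻ ξ in D, g (z + Complex.exp (θ * Complex.I) • ξ) := by
        refine lintegral_lintegral_swap ?_
        refine Measurable.aemeasurable (hgm.comp ?_)
        fun_prop
    _ = ∫⁻ θ in Set.Ioc 0 (2 * Real.pi), ∫⁻ ξ in D, g (z + ξ) := by
        refine lintegral_congr fun θ => ?_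
        have hmp := (phaseRotation n θ).measurePreserving
        have hpre : (phaseRotation n θ) ⁻¹' D = D := by
          ext ξ
          refine ⟨fun hξ => ?_, fun hξ => hrot θ ξ hξ⟩
          have := hrot (-θ) _ hξ
          rwa [phaseRotation_apply, smul_smul, ← Complex.exp_add, Complex.ofReal_neg, neg_mul,
            neg_add_cancel, Complex.exp_zero, one_smul] at this
        have := hmp.setLIntegral_comp_preimage hD
          (f := fun ξ => g (z + ξ)) (hgm.comp (by fun_prop))
        rw [hpre] at this
        rw [← this]
        rfl
    _ = ENNReal.ofReal (2 * Real.pi) * ∫⁻ ξ in D, ENNReal.ofReal (w (z + ξ)) := by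
        rw [lintegral_const, Measure.restrict_apply_univ, Real.volume_Ioc, sub_zero, mul_comm]
        congr 1
        exact setLIntegral_congr_fun hD hgD

/-! ### Second differences and subharmonicity in the sense of distributions -/

section SecondDifference
variable {E : Type*} [NormedAddCommGroup E] [NormedSpace ℝ E]

theorem abs_second_difference_le {χ : E → ℝ} (hχ : ContDiff ℝ 2 χ) {M : ℝ}
    (hM : ∀ z, ‖fderiv ℝ (fderiv ℝ χ) z‖ ≤ M) (z v : E) :
    |χ (z + v) + χ (z - v) - 2 * χ z| ≤ M * ‖v‖ ^ 2 := by
  have h1 : ContDiff ℝ 1 (fderiv ℝ χ) := hχ.fderiv_right (by norm_num)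
  have hd : Differentiable ℝ χ := hχ.differentiable (by norm_num)
  have hlip : ∀ y, ‖fderiv ℝ χ (y + v) - fderiv ℝ χ y‖ ≤ M * ‖v‖ := fun y => by
    have := convex_univ.norm_image_sub_le_of_norm_fderiv_le (𝕜 := ℝ) (f := fderiv ℝ χ)
      (fun x _ => (h1.differentiable (by norm_num)) x) (fun x _ => hM x)
      (Set.mem_univ y) (Set.mem_univ (y + v))
    simpa using this
  -- The second difference is the increment of y ↦ χ(y + v) - χ(y) from z - v to z.
  have := convex_univ.norm_image_sub_le_of_norm_hasFDerivWithin_le (𝕜 := ℝ)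
    (f := fun y => χ (y + v) - χ y) (f' := fun y => fderiv ℝ χ (y + v) - fderiv ℝ χ y)
    (fun x _ => (((hasFDerivAt_comp_add_right v).2 (hd (x + v)).hasFDerivAt).sub
      (hd x).hasFDerivAt).hasFDerivWithinAt) (fun x _ => hlip x)
    (Set.mem_univ (z - v)) (Set.mem_univ z)
  rw [Real.norm_eq_abs] at this
  convert! this using 1
  · congr 1
    simp only [sub_add_cancel]; ring
  · simp only [sub_sub_cancel]; ring

theorem tendsto_second_difference {χ : E → ℝ} (hχ : ContDiff ℝ 2 χ) (z v : E) :
    Filter.Tendsto (fun r : ℝ => (χ (z + r • v) + χ (z - r • v) - 2 * χ z) / r ^ 2) (𝓝[>] 0)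
      (𝓝 (fderiv ℝ (fderiv ℝ χ) z v v)) := by
  have h1 : ContDiff ℝ 1 (fderiv ℝ χ) := hχ.fderiv_right (by norm_num)
  have hd : Differentiable ℝ χ := hχ.differentiable (by norm_num)
  have hline : ∀ t : ℝ, HasDerivAt (fun r : ℝ => χ (z + r • v)) (fderiv ℝ χ (z + t • v) v) t := by
    intro t
    have hg : HasDerivAt (fun r : ℝ => z + r • v) v t := by
      simpa using ((hasDerivAt_id t).smul_const v).const_add z
    exact (hd _).hasFDerivAt.comp_hasDerivAt t hg
  have hline' : ∀ t : ℝ, HasDerivAt (fun r : ℝ => χ (z - r • v)) (-fderiv ℝ χ (z - t • v) v) t := by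
    intro t
    have hg : HasDerivAt (fun r : ℝ => z - r • v) (-v) t := by
      simpa using ((hasDerivAt_id t).smul_const v).const_sub z
    have := (hd _).hasFDerivAt.comp_hasDerivAt t hg
    rw [map_neg] at this
    exact this
  have hd2 : HasDerivAt (fun r : ℝ => fderiv ℝ χ (z + r • v) v - fderiv ℝ χ (z - r • v) v)
      (2 * fderiv ℝ (fderiv ℝ χ) z v v) 0 := by
    have hg : HasDerivAt (fun r : ℝ => z + r • v) v 0 := by
      simpa using ((hasDerivAt_id (0:ℝ)).smul_const v).const_add z
    have hg' : HasDerivAt (fun r : ℝ => z - r • v) (-v) 0 := by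
      simpa using ((hasDerivAt_id (0:ℝ)).smul_const v).const_sub z
    have hf := (h1.differentiable (by norm_num) z).hasFDerivAt
    have a1 : HasDerivAt (fun r : ℝ => fderiv ℝ χ (z + r • v)) (fderiv ℝ (fderiv ℝ χ) z v) 0 := by
      refine HasFDerivAt.comp_hasDerivAt 0 ?_ hg
      simpa using hf
    have a2 : HasDerivAt (fun r : ℝ => fderiv ℝ χ (z - r • v)) (fderiv ℝ (fderiv ℝ χ) z (-v)) 0 := by
      refine HasFDerivAt.comp_hasDerivAt 0 ?_ hg'
      simpa using hf
    have b1 := a1.clm_apply (hasDerivAt_const (0:ℝ) v)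
    have b2 := a2.clm_apply (hasDerivAt_const (0:ℝ) v)
    convert! b1.sub b2 using 1
    simp; ring
  -- One application suffices: the quotient of derivatives is half the difference quotient at 0 of
  -- the function in `hd2`, so no second derivative is needed away from z.
  refine HasDerivAt.lhopital_zero_nhdsGT (f' := fun t => fderiv ℝ χ (z + t • v) v - fderiv ℝ χ (z - t • v) v)
    (g' := fun t => 2 * t) ?_ ?_ ?_ ?_ ?_ ?_
  · exact Filter.Eventually.of_forall fun t => by
      simpa [sub_eq_add_neg] using ((hline t).add (hline' t)).sub_const (2 * χ z)
  · exact Filter.Eventually.of_forall fun t => by simpa using hasDerivAt_pow 2 t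
  · filter_upwards [self_mem_nhdsWithin] with t ht
    have : (0 : ℝ) < t := ht
    positivity
  · have : Filter.Tendsto (fun r : ℝ => χ (z + r • v) + χ (z - r • v) - 2 * χ z) (𝓝 0)
        (𝓝 (χ (z + (0:ℝ) • v) + χ (z - (0:ℝ) • v) - 2 * χ z)) := by
      refine Continuous.tendsto ?_ 0
      have := hχ.continuous
      fun_prop
    refine (this.mono_left nhdsWithin_le_nhds).trans_eq ?_
    simp; ring
  · have : Filter.Tendsto (fun r : ℝ => r ^ 2) (𝓝 0) (𝓝 ((0 : ℝ) ^ 2)) :=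
      (continuous_pow 2).tendsto 0
    exact (this.mono_left nhdsWithin_le_nhds).trans_eq (by simp)
  · have := hd2.tendsto_slope_zero_right
    simp only [zero_add, zero_smul, add_zero, sub_zero, sub_self, smul_eq_mul] at this
    have h2 := this.const_mul (1/2 : ℝ)
    refine (h2.congr fun t => ?_).trans_eq ?_
    · rw [div_eq_mul_inv _ (2 * t), mul_inv]; ring
    · congr 1; ring

theorem exists_bound_fderiv {F : Type*} [NormedAddCommGroup F] [NormedSpace ℝ F] {g : E → F}
    (hg : ContDiff ℝ 1 g) (hs : HasCompactSupport g) : ∃ M, ∀ z, ‖fderiv ℝ g z‖ ≤ M :=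
  (hg.continuous_fderiv (by norm_num)).bounded_above_of_compact_support (hs.fderiv ℝ)

theorem exists_bound_fderiv_fderiv {χ : E → ℝ} (hχ : ContDiff ℝ 2 χ) (hs : HasCompactSupport χ) :
    ∃ M, ∀ z, ‖fderiv ℝ (fderiv ℝ χ) z‖ ≤ M :=
  exists_bound_fderiv (hχ.fderiv_right (by norm_num)) (hs.fderiv ℝ)

theorem fderiv_fderiv_eq_zero {χ : E → ℝ} {z : E} (hz : z ∉ tsupport χ) :
    fderiv ℝ (fderiv ℝ χ) z = 0 :=
  image_eq_zero_of_notMem_tsupport fun h =>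
    hz (tsupport_fderiv_subset ℝ (tsupport_fderiv_subset ℝ h))

end SecondDifference

/-- The real Laplacian of `χ` restricted to the complex line through `z` in direction `ξ`. -/
noncomputable def lineLaplacian {n : ℕ} (χ : CSpace n → ℝ) (ξ z : CSpace n) : ℝ :=
  fderiv ℝ (fderiv ℝ χ) z ξ ξ + fderiv ℝ (fderiv ℝ χ) z (Complex.I • ξ) (Complex.I • ξ)

/-- The trace of a bilinear form on the real plane spanned by ξ and iξ is rotation invariant; the
mixed terms cancel without using symmetry of the second derivative. -/
theorem lineLaplacian_rotate {n : ℕ} (χ : CSpace n → ℝ) (ξ z : CSpace n)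
    (θ : ℝ) : lineLaplacian χ (Complex.exp (θ * Complex.I) • ξ) z = lineLaplacian χ ξ z := by
  set B := fderiv ℝ (fderiv ℝ χ) z
  have e1 : Complex.exp (θ * Complex.I) • ξ = Real.cos θ • ξ + Real.sin θ • (Complex.I • ξ) := by
    rw [Complex.exp_mul_I, add_smul, ← Complex.ofReal_cos, ← Complex.ofReal_sin, mul_smul,
      Complex.coe_smul, Complex.coe_smul]
  have e2 : Complex.I • Complex.exp (θ * Complex.I) • ξ =
      Real.cos θ • (Complex.I • ξ) - Real.sin θ • ξ := by
    rw [e1, smul_add, smul_comm Complex.I (Real.cos θ), smul_comm Complex.I (Real.sin θ),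
      smul_smul, Complex.I_mul_I, neg_one_smul, smul_neg, sub_eq_add_neg]
  unfold lineLaplacian
  rw [e2, e1]
  simp only [map_add, map_sub, map_smul, add_apply, sub_apply,
    smul_apply, smul_eq_mul]
  have := Real.sin_sq_add_cos_sq θ
  linear_combination (B ξ ξ + B (Complex.I • ξ) (Complex.I • ξ)) * this

/-- The circle inequality for w, taken in the direction -ξ and multiplied by χ, is moved onto χ by
translating the integration variable by e^{iθ}ξ. Thus w need not be differentiable. -/
theorem DiscSubmean.lintegral_mul_le {n : ℕ} {Ω : Set (CSpace n)}
    {w : CSpace n → ℝ} (hw : DiscSubmean Ω w) {K K' : Set (CSpace n)} (hK' : MeasurableSet K')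
    (hK'Ω : K' ⊆ Ω) {ξ : CSpace n} (hξ : ∀ z ∈ K, ∀ ζ : ℂ, ‖ζ‖ ≤ 1 → z + ζ • ξ ∈ K')
    {χ : CSpace n → ℝ} (hχc : Continuous χ) (hχK : ∀ z ∉ K, χ z = 0) :
    ENNReal.ofReal (2 * Real.pi) * ∫⁻ z, K'.indicator (fun z => ENNReal.ofReal (w z)) z *
        ENNReal.ofReal (χ z) ≤
      ∫⁻ θ in Set.Ioc 0 (2 * Real.pi), ∫⁻ z, K'.indicator (fun z => ENNReal.ofReal (w z)) z *
        ENNReal.ofReal (χ (z + Complex.exp (θ * Complex.I) • ξ)) := by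
  set W : CSpace n → ℝ≥0∞ := K'.indicator (fun z => ENNReal.ofReal (w z)) with hW
  have hWm : Measurable W := by
    have : Measurable (K'.indicator w) := by
      classical
      rw [← Set.piecewise_eq_indicator]
      exact (hw.continuousOn.mono hK'Ω).measurable_piecewise continuousOn_const hK'
    have e : W = fun x => ENNReal.ofReal (K'.indicator w x) := by
      ext x
      by_cases hx : x ∈ K' <;> simp [hW, hx]
    rw [e]
    exact this.ennreal_ofReal
  have hχm : Measurable fun z => ENNReal.ofReal (χ z) := hχc.measurable.ennreal_ofReal
  have hneg : ∀ z ∈ K, ∀ ζ : ℂ, ‖ζ‖ ≤ 1 → z + ζ • (-ξ) ∈ K' := fun z hz ζ hζ => by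
    have := hξ z hz (-ζ) (by rwa [norm_neg])
    rwa [neg_smul, ← smul_neg] at this
  calc _ = ∫⁻ z, ENNReal.ofReal (2 * Real.pi) * (W z * ENNReal.ofReal (χ z)) := by
        rw [lintegral_const_mul]
        exact hWm.mul hχm
    _ ≤ ∫⁻ z, ∫⁻ θ in Set.Ioc 0 (2 * Real.pi),
          W (z + Complex.exp (θ * Complex.I) • (-ξ)) * ENNReal.ofReal (χ z) := by
        refine lintegral_mono fun z => ?_
        by_cases hz : z ∈ K
        · have hzK' : z ∈ K' := by simpa using hξ z hz 0 (by simp)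
          have h1 := hw.mul_le_lintegral_circle fun ζ hζ => hK'Ω (hneg z hz ζ hζ)
          rw [lintegral_mul_const]
          · rw [← mul_assoc]
            refine mul_le_mul_left ?_ _
            rw [mul_comm]
            simp only [hW, Set.indicator_of_mem hzK']
            refine h1.trans_eq (lintegral_congr fun θ => ?_)
            rw [Set.indicator_of_mem (hneg z hz _ (Complex.norm_exp_ofReal_mul_I θ).le)]
          · exact hWm.comp (by fun_prop)
        · simp [hχK z hz]
    _ = ∫⁻ θ in Set.Ioc 0 (2 * Real.pi), ∫⁻ z,
          W (z + Complex.exp (θ * Complex.I) • (-ξ)) * ENNReal.ofReal (χ z) := by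
        refine lintegral_lintegral_swap (Measurable.aemeasurable ?_)
        exact (hWm.comp (by fun_prop)).mul (hχm.comp (by fun_prop))
    _ = _ := by
        refine lintegral_congr fun θ => ?_
        rw [← lintegral_add_right_eq_self _ (Complex.exp (θ * Complex.I) • ξ)]
        simp

/-- Averaged over rotations, w pairs nonnegatively with χ(· + rη) - χ for small r. Summing over the
four directions ±ξ, ±iξ and dividing by r² produces second differences of χ, which converge
boundedly to the line Laplacian. By rotation invariance the limit does not depend on θ. -/
theorem DiscSubmean.integral_lineLaplacian_nonneg {n : ℕ} {Ω : Set (CSpace n)} (hΩ : IsOpen Ω)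
    {w : CSpace n → ℝ} (hw : DiscSubmean Ω w) {χ : CSpace n → ℝ} (hχ : ContDiff ℝ 2 χ)
    (hχ0 : ∀ z, 0 ≤ χ z) (hχs : HasCompactSupport χ) (hχΩ : tsupport χ ⊆ Ω) (ξ : CSpace n) :
    0 ≤ ∫ z, w z * lineLaplacian χ ξ z := by
  obtain ⟨ε, hε, hεΩ⟩ := IsCompact.exists_cthickening_subset_open hχs hΩ hχΩ
  set K' := Metric.cthickening ε (tsupport χ) with hK'
  have hK'c : IsCompact K' := IsCompact.cthickening hχs
  have hK'm : MeasurableSet K' := hK'c.isClosed.measurableSet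
  obtain ⟨Mw, hMw⟩ := hK'c.exists_bound_of_continuousOn (hw.continuousOn.mono hεΩ)
  obtain ⟨Mχ, hMχ⟩ := hχ.continuous.bounded_above_of_compact_support hχs
  obtain ⟨M, hM⟩ := exists_bound_fderiv_fderiv hχ hχs
  set W : CSpace n → ℝ := K'.indicator w with hW
  have hWm : Measurable W := by
    classical
    rw [hW, ← Set.piecewise_eq_indicator]
    exact (hw.continuousOn.mono hεΩ).measurable_piecewise continuousOn_const hK'm
  have hW0 : ∀ z, 0 ≤ W z := fun z => Set.indicator_nonneg (fun z _ => hw.nonneg z) z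
  have hWb : ∀ z, |W z| ≤ K'.indicator (fun _ => Mw) z := fun z => by
    by_cases hz : z ∈ K'
    · simpa [hW, hz] using hMw z hz
    · simp [hW, hz]
  let ν : Measure ℝ := volume.restrict (Set.Ioc 0 (2 * Real.pi))
  have hind : ∀ c : ℝ, Integrable (fun x : ℝ × CSpace n => K'.indicator (fun _ => Mw) x.2 * c)
      (ν.prod volume) := fun c => by
    have : Integrable (K'.indicator (fun _ => Mw)) (volume : Measure (CSpace n)) :=
      (integrable_indicator_iff hK'm).2 (integrableOn_const hK'c.measure_lt_top.ne)
    exact (this.comp_snd ν).mul_const c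
  have hFint : ∀ η : CSpace n, Integrable
      (fun x : ℝ × CSpace n => W x.2 * χ (x.2 + Complex.exp (x.1 * Complex.I) • η))
      (ν.prod volume) := fun η => by
    refine (hind Mχ).mono' ?_ (ae_of_all _ fun x => ?_)
    · refine Measurable.aestronglyMeasurable ?_
      refine (hWm.comp measurable_snd).mul (hχ.continuous.measurable.comp ?_)
      fun_prop
    · rw [norm_mul]
      exact mul_le_mul (hWb _) (hMχ _) (norm_nonneg _) ((abs_nonneg _).trans (hWb _))
  have hstep : ∀ η : CSpace n, ‖η‖ ≤ ε → 0 ≤ ∫ x : ℝ × CSpace n,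
      (W x.2 * χ (x.2 + Complex.exp (x.1 * Complex.I) • η) - W x.2 * χ x.2) ∂(ν.prod volume) := by
    intro η hη
    have hF0 : Integrable (fun x : ℝ × CSpace n => W x.2 * χ x.2) (ν.prod volume) := by
      simpa using hFint 0
    rw [integral_sub (hFint η) hF0, sub_nonneg, integral_eq_lintegral_of_nonneg_ae
      (ae_of_all _ fun x => mul_nonneg (hW0 _) (hχ0 _)) hF0.aestronglyMeasurable,
      integral_eq_lintegral_of_nonneg_ae (ae_of_all _ fun x => mul_nonneg (hW0 _) (hχ0 _))
      (hFint η).aestronglyMeasurable]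
    refine ENNReal.toReal_mono (hasFiniteIntegral_iff_ofReal
      (ae_of_all _ fun x => mul_nonneg (hW0 _) (hχ0 _)) |>.1 (hFint η).2).ne ?_
    have hE : ∀ z, ENNReal.ofReal (W z) = K'.indicator (fun z => ENNReal.ofReal (w z)) z := by
      intro z
      by_cases hz : z ∈ K' <;> simp [hW, hz]
    have := hw.lintegral_mul_le hK'm hεΩ (K := tsupport χ) (ξ := η) (χ := χ)
      (fun z hz ζ hζ => by
        refine Metric.mem_cthickening_of_dist_le _ z _ _ hz ?_
        rw [dist_eq_norm, add_sub_cancel_left, norm_smul]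
        calc ‖ζ‖ * ‖η‖ ≤ 1 * ‖η‖ := by gcongr
          _ ≤ ε := by rwa [one_mul]) hχ.continuous
      (fun z hz => image_eq_zero_of_notMem_tsupport hz)
    simp only [← hE, ← ENNReal.ofReal_mul (hW0 _)] at this
    rw [lintegral_prod _ hF0.aestronglyMeasurable.aemeasurable.ennreal_ofReal,
      lintegral_prod _ (hFint η).aestronglyMeasurable.aemeasurable.ennreal_ofReal]
    refine le_trans (le_of_eq ?_) this
    simp [ν, mul_comm]
  -- All four translates are kept so that the integrand converges for each θ separately.
  let G : ℝ → ℝ × CSpace n → ℝ := fun r x =>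
    let v := Complex.exp (x.1 * Complex.I) • ξ
    W x.2 * ((χ (x.2 + r • v) + χ (x.2 - r • v) - 2 * χ x.2) / r ^ 2 +
      (χ (x.2 + r • (Complex.I • v)) + χ (x.2 - r • (Complex.I • v)) - 2 * χ x.2) / r ^ 2)
  have hlim : Filter.Tendsto (fun r => ∫ x, G r x ∂(ν.prod volume)) (𝓝[>] 0)
      (𝓝 (∫ x, W x.2 * lineLaplacian χ ξ x.2 ∂(ν.prod volume))) := by
    refine tendsto_integral_filter_of_dominated_convergence
      (fun x => K'.indicator (fun _ => Mw) x.2 * (2 * (M * ‖ξ‖ ^ 2))) ?_ ?_ (hind _) ?_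
    · refine Filter.Eventually.of_forall fun r => Measurable.aestronglyMeasurable ?_
      have hc := hχ.continuous.measurable
      refine (hWm.comp measurable_snd).mul (Measurable.add ?_ ?_)
      all_goals
        refine Measurable.div_const (Measurable.sub (Measurable.add ?_ ?_) ?_) _
        · exact hc.comp (by fun_prop)
        · exact hc.comp (by fun_prop)
        · exact (hc.comp measurable_snd).const_mul 2
    · filter_upwards [self_mem_nhdsWithin] with r hr
      have hr : (0 : ℝ) < r := hr
      refine ae_of_all _ fun x => ?_
      have key : ∀ v : CSpace n, ‖v‖ = ‖ξ‖ →
          |(χ (x.2 + r • v) + χ (x.2 - r • v) - 2 * χ x.2) / r ^ 2| ≤ M * ‖ξ‖ ^ 2 := fun v hv => by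
        have := abs_second_difference_le hχ hM x.2 (r • v)
        rw [abs_div, abs_of_pos (by positivity : 0 < r ^ 2), div_le_iff₀ (by positivity)]
        rw [norm_smul, hv, Real.norm_of_nonneg hr.le] at this
        linarith
      rw [Real.norm_eq_abs, abs_mul]
      refine mul_le_mul (hWb _) ?_ (abs_nonneg _) ((abs_nonneg _).trans (hWb _))
      refine (abs_add_le _ _).trans ?_
      have n1 : ‖Complex.exp (x.1 * Complex.I) • ξ‖ = ‖ξ‖ := by
        rw [norm_smul, Complex.norm_exp_ofReal_mul_I, one_mul]
      have n2 : ‖Complex.I • Complex.exp (x.1 * Complex.I) • ξ‖ = ‖ξ‖ := by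
        rw [norm_smul, Complex.norm_I, one_mul, n1]
      linarith [key _ n1, key _ n2]
    · refine ae_of_all _ fun x => ?_
      rw [← lineLaplacian_rotate χ ξ x.2 x.1]
      exact ((tendsto_second_difference hχ _ _).add (tendsto_second_difference hχ _ _)).const_mul _
  have hGpos : ∀ᶠ r in 𝓝[>] (0 : ℝ), 0 ≤ ∫ x, G r x ∂(ν.prod volume) := by
    have hr0 : 0 < ε / (‖ξ‖ + 1) := by positivity
    filter_upwards [Ioo_mem_nhdsGT hr0] with r hr
    have hrξ : r * ‖ξ‖ ≤ ε := by
      have := (lt_div_iff₀ (by positivity)).1 hr.2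
      nlinarith [hr.1, norm_nonneg ξ]
    have hn : ∀ c : ℂ, ‖c‖ = 1 → ‖(r : ℂ) • c • ξ‖ ≤ ε := fun c hc => by
      rw [norm_smul, norm_smul, hc, one_mul, Complex.norm_real, Real.norm_of_nonneg hr.1.le]
      exact hrξ
    have e : ∀ x, G r x = (r ^ 2)⁻¹ *
        ((W x.2 * χ (x.2 + Complex.exp (x.1 * Complex.I) • ((r : ℂ) • (1 : ℂ) • ξ)) - W x.2 * χ x.2) +
        (W x.2 * χ (x.2 + Complex.exp (x.1 * Complex.I) • ((r : ℂ) • (-1 : ℂ) • ξ)) - W x.2 * χ x.2) +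
        (W x.2 * χ (x.2 + Complex.exp (x.1 * Complex.I) • ((r : ℂ) • Complex.I • ξ))
          - W x.2 * χ x.2) +
        (W x.2 * χ (x.2 + Complex.exp (x.1 * Complex.I) • ((r : ℂ) • (-Complex.I) • ξ))
          - W x.2 * χ x.2)) := by
      intro x
      simp only [G]
      rw [smul_comm (Complex.exp _) (r : ℂ), smul_comm (Complex.exp _) (r : ℂ),
        smul_comm (Complex.exp _) (r : ℂ), smul_comm (Complex.exp _) (r : ℂ)]
      simp only [neg_smul, one_smul, smul_neg, ← sub_eq_add_neg, Complex.coe_smul]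
      rw [smul_comm Complex.I]
      ring
    simp only [e]
    have hi : ∀ η, Integrable (fun x : ℝ × CSpace n =>
        W x.2 * χ (x.2 + Complex.exp (x.1 * Complex.I) • η) - W x.2 * χ x.2) (ν.prod volume) :=
      fun η => (hFint η).sub (by simpa using hFint 0)
    rw [integral_const_mul, integral_add ?_ (hi _), integral_add ?_ (hi _),
      integral_add (hi _) (hi _)]
    rotate_left
    · exact (hi _).add (hi _)
    · exact ((hi _).add (hi _)).add (hi _)
    have p := fun c hc => hstep _ (hn c hc)
    have := p 1 (by simp)
    have := p (-1) (by simp)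
    have := p Complex.I (by simp)
    have := p (-Complex.I) (by simp)
    have := hr.1
    positivity
  have hge := ge_of_tendsto hlim hGpos
  -- The limiting integrand is constant in θ, so the θ-integral only contributes the positive factor
  -- 2π.
  have hprod := integral_prod_mul (μ := ν) (ν := (volume : Measure (CSpace n)))
    (fun _ => (1 : ℝ)) (fun z => W z * lineLaplacian χ ξ z)
  simp only [one_mul] at hprod
  rw [hprod] at hge
  have hpi : 0 < ∫ _ : ℝ, (1 : ℝ) ∂ν := by
    simp [ν, Measure.real, ENNReal.toReal_ofReal Real.pi_pos.le, Real.pi_pos]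
  have hWw : ∫ z, W z * lineLaplacian χ ξ z = ∫ z, w z * lineLaplacian χ ξ z := by
    refine integral_congr_ae (ae_of_all _ fun z => ?_)
    by_cases hz : z ∈ K'
    · simp [hW, hz]
    · have hz' : z ∉ tsupport χ := fun h => hz (Metric.self_subset_cthickening _ h)
      simp [lineLaplacian, fderiv_fderiv_eq_zero hz']
  rw [hWw] at hge
  exact nonneg_of_mul_nonneg_right hge hpi

/-! ### A global C² defining function -/

/-- Multiplying -ρ by a bump function keeps its sign on each side of the boundary and loses only
strictness. Weak signs are what survives summation. -/
theorem exists_local_defining_function {n : ℕ} {Ω : Set (CSpace n)} (hbd : HasC2Boundary Ω)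
    {x : CSpace n} (hx : x ∈ frontier Ω) : ∃ σ : CSpace n → ℝ, ContDiff ℝ 2 σ ∧
      HasCompactSupport σ ∧ (∀ z ∈ Ω, 0 ≤ σ z) ∧ (∀ z ∉ Ω, σ z ≤ 0) ∧
      ∀ᶠ y in 𝓝 x, fderiv ℝ σ y ≠ 0 := by
  obtain ⟨ρ, hρ, hdρ, hiff⟩ := hbd x hx
  have h1 : ∀ᶠ y in 𝓝 x, ContDiffAt ℝ 2 ρ y := hρ.eventually (by simp)
  have h2 : ∀ᶠ y in 𝓝 x, fderiv ℝ ρ y ≠ 0 := by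
    have : ContinuousAt (fderiv ℝ ρ) x := (hρ.fderiv_right (m := 1) (by norm_num)).continuousAt
    exact this.eventually_ne hdρ
  obtain ⟨r, hr, hball⟩ := Metric.eventually_nhds_iff_ball.1 (h1.and hiff)
  let b : ContDiffBump x := ⟨r / 3, r / 2, by positivity, by linarith⟩
  refine ⟨fun z => -(b z * ρ z), ?_, ?_, ?_, ?_, ?_⟩
  · refine contDiff_iff_contDiffAt.2 fun y => ?_
    by_cases hy : y ∈ Metric.ball x r
    · exact ((b.contDiff.contDiffAt).mul (hball y hy).1).neg
    · have hy' : y ∉ tsupport b := by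
        rw [b.tsupport_eq]
        intro h
        apply hy
        have h' : dist y x ≤ r / 2 := h
        rw [Metric.mem_ball]
        linarith
      have : (fun z => -(b z * ρ z)) =ᶠ[𝓝 y] fun _ => 0 := by
        filter_upwards [notMem_tsupport_iff_eventuallyEq.1 hy'] with z hz
        simp [hz]
      exact contDiffAt_const.congr_of_eventuallyEq this
  · exact (b.hasCompactSupport.mul_right).neg
  · intro z hz
    by_cases hzb : z ∈ Metric.ball x r
    · have := ((hball z hzb).2.1 hz)
      have := b.nonneg (x := z)
      simp only
      nlinarith
    · have : b z = 0 := b.zero_of_le_dist (by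
        rw [Metric.mem_ball] at hzb
        change r / 2 ≤ _
        linarith)
      simp [this]
  · intro z hz
    by_cases hzb : z ∈ Metric.ball x r
    · have h3 : 0 ≤ ρ z := not_lt.1 fun h => hz ((hball z hzb).2.2 h)
      have := b.nonneg (x := z)
      simp only
      nlinarith [mul_nonneg this h3]
    · have : b z = 0 := b.zero_of_le_dist (by
        rw [Metric.mem_ball] at hzb
        change r / 2 ≤ _
        linarith)
      simp [this]
  · have h3 : ∀ᶠ y in 𝓝 x, ∀ᶠ z in 𝓝 y, b z = 1 :=
      eventually_eventually_nhds.2 b.eventuallyEq_one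
    filter_upwards [h2, h3] with y hy hby
    have : (fun z => -(b z * ρ z)) =ᶠ[𝓝 y] fun z => -ρ z := by
      filter_upwards [hby] with z hz
      simp [hz]
    rw [this.fderiv_eq, fderiv_fun_neg]
    simpa using hy

/-- Finitely many local functions are added, together with a smooth nonnegative η with support set Ω
that restores strict positivity. The differentials cannot cancel at a boundary point: a direction in
which one local function increases enters Ω, and every summand vanishes at the point and is
nonnegative on Ω, so has nonnegative derivative in that direction. -/
theorem exists_defining_function {n : ℕ} {Ω : Set (CSpace n)} (hΩ : IsBoundedDomain Ω)
    (hbd : HasC2Boundary Ω) : ∃ τ : CSpace n → ℝ, ContDiff ℝ 2 τ ∧ HasCompactSupport τ ∧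
      (∀ z, z ∈ Ω ↔ 0 < τ z) ∧ ∀ x ∈ frontier Ω, fderiv ℝ τ x ≠ 0 := by
  have hK : IsCompact (frontier Ω) :=
    Metric.isCompact_of_isClosed_isBounded isClosed_frontier
      (hΩ.isBounded.closure.subset frontier_subset_closure)
  choose! σ hσ hσs hσ0 hσ1 hσd using fun x (hx : x ∈ frontier Ω) =>
    exists_local_defining_function hbd hx
  obtain ⟨t, htK, ht⟩ := hK.elim_nhds_subcover (fun x => {y | fderiv ℝ (σ x) y ≠ 0}) hσd
  obtain ⟨η, hηs, hη, hη0⟩ := hΩ.isOpen.exists_contDiff_support_eq (n := 2)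
  have hη_nonneg : ∀ z, 0 ≤ η z := fun z => (hη0 ⟨z, rfl⟩).1
  have hηc : HasCompactSupport η := by
    rw [HasCompactSupport, tsupport, hηs]
    exact Metric.isCompact_of_isClosed_isBounded isClosed_closure hΩ.isBounded.closure
  have hη_out : ∀ z, z ∉ Ω → η z = 0 := fun z hz => by
    rw [← hηs] at hz; simpa using hz
  refine ⟨fun z => (∑ x ∈ t, σ x z) + η z, ?_, ?_, fun z => ⟨fun hz => ?_, fun hz => ?_⟩, ?_⟩
  · exact (ContDiff.sum fun x hx => hσ x (htK x hx)).add hη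
  · refine HasCompactSupport.add ?_ hηc
    have : ∀ s : Finset (CSpace n), (∀ x ∈ s, HasCompactSupport (σ x)) →
        HasCompactSupport (fun z => ∑ x ∈ s, σ x z) := by
      classical
      intro s
      induction s using Finset.induction_on with
      | empty => intro _; simp only [Finset.sum_empty]; exact HasCompactSupport.zero
      | insert a s ha ih =>
        intro h
        simp only [Finset.sum_insert ha]
        exact (h a (by simp)).add (ih fun x hx => h x (by simp [hx]))
    exact this t fun x hx => hσs x (htK x hx)
  · have h1 : 0 < η z := lt_of_le_of_ne (hη_nonneg z) (Ne.symm (by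
      rw [← Function.mem_support, hηs]; exact hz))
    have h2 : 0 ≤ ∑ x ∈ t, σ x z := Finset.sum_nonneg fun x hx => hσ0 x (htK x hx) z hz
    linarith
  · by_contra h
    have h2 : ∑ x ∈ t, σ x z ≤ 0 := Finset.sum_nonpos fun x hx => hσ1 x (htK x hx) z h
    have := hη_out z h
    simp only at hz
    linarith
  · intro y hy
    have hyΩ : y ∉ Ω := by rw [hΩ.isOpen.frontier_eq] at hy; exact hy.2
    have hσy : ∀ x ∈ frontier Ω, σ x y = 0 := fun x hx => by
      refine le_antisymm (hσ1 x hx y hyΩ) ?_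
      have hcl : closure Ω ⊆ {z | 0 ≤ σ x z} :=
        closure_minimal (fun z hz => hσ0 x hx z hz)
          (isClosed_le continuous_const (hσ x hx).continuous)
      exact hcl (frontier_subset_closure hy)
    obtain ⟨x0, hx0t, hx0⟩ := Set.mem_iUnion₂.1 (ht hy)
    have hx0d : fderiv ℝ (σ x0) y ≠ 0 := hx0
    obtain ⟨ν, hν⟩ : ∃ ν, 0 < fderiv ℝ (σ x0) y ν := by
      obtain ⟨v, hv⟩ : ∃ v, fderiv ℝ (σ x0) y v ≠ 0 := by
        by_contra! h
        exact hx0d (ContinuousLinearMap.ext h)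
      rcases lt_or_gt_of_ne hv with h | h
      · exact ⟨-v, by rw [map_neg]; linarith⟩
      · exact ⟨v, h⟩
    have hline : ∀ g : CSpace n → ℝ, ContDiff ℝ 2 g → g y = 0 →
        Filter.Tendsto (fun s : ℝ => s⁻¹ * g (y + s • ν)) (𝓝[>] 0) (𝓝 (fderiv ℝ g y ν)) := by
      intro g hg hgy
      have hd : HasDerivAt (fun s : ℝ => g (y + s • ν)) (fderiv ℝ g y ν) 0 := by
        have hl : HasDerivAt (fun s : ℝ => y + s • ν) ν 0 := by
          simpa using ((hasDerivAt_id (0 : ℝ)).smul_const ν).const_add y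
        refine HasFDerivAt.comp_hasDerivAt 0 ?_ hl
        simpa using (hg.differentiable (by norm_num) y).hasFDerivAt
      have := hd.tendsto_slope_zero_right
      simpa [hgy] using this
    -- A point where σ x0 is positive cannot lie outside Ω.
    have hinΩ : ∀ᶠ s in 𝓝[>] (0 : ℝ), y + s • ν ∈ Ω := by
      have := (hline (σ x0) (hσ x0 (htK x0 hx0t)) (hσy x0 (htK x0 hx0t))).eventually_const_lt hν
      filter_upwards [this, self_mem_nhdsWithin] with s hs hs0
      by_contra h
      have h1 := hσ1 x0 (htK x0 hx0t) _ h
      have h2 : (0:ℝ) < s⁻¹ := inv_pos.2 hs0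
      nlinarith
    have hpos : ∀ g : CSpace n → ℝ, ContDiff ℝ 2 g → g y = 0 → (∀ z ∈ Ω, 0 ≤ g z) →
        0 ≤ fderiv ℝ g y ν := by
      intro g hg hgy hg0
      refine ge_of_tendsto (hline g hg hgy) ?_
      filter_upwards [hinΩ, self_mem_nhdsWithin] with s hs hs0
      exact mul_nonneg (inv_nonneg.2 (le_of_lt hs0)) (hg0 _ hs)
    have hda : ∀ x ∈ t, DifferentiableAt ℝ (σ x) y := fun x hx =>
      (hσ x (htK x hx)).differentiable (by norm_num) y
    have hdη : DifferentiableAt ℝ η y := hη.differentiable (by norm_num) y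
    have e : fderiv ℝ (fun z => (∑ x ∈ t, σ x z) + η z) y =
        (∑ x ∈ t, fderiv ℝ (σ x) y) + fderiv ℝ η y := by
      rw [fderiv_fun_add (DifferentiableAt.fun_sum hda) hdη, fderiv_fun_sum hda]
    intro h0
    have h1 : (fderiv ℝ (fun z => (∑ x ∈ t, σ x z) + η z) y) ν = 0 := by rw [h0]; rfl
    rw [e, add_apply, sum_apply] at h1
    have h2 : 0 ≤ fderiv ℝ η y ν := hpos η hη (hη_out y hyΩ) fun z _ => hη_nonneg z
    have h3 : fderiv ℝ (σ x0) y ν ≤ ∑ x ∈ t, fderiv ℝ (σ x) y ν :=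
      Finset.single_le_sum (f := fun x => fderiv ℝ (σ x) y ν)
        (fun x hx => hpos (σ x) (hσ x (htK x hx)) (hσy x (htK x hx)) (hσ0 x (htK x hx))) hx0t
    linarith

/-- A global `C²` defining function, positive inside the domain. -/
structure IsDefiningFunction {n : ℕ} (Ω : Set (CSpace n)) (τ : CSpace n → ℝ) : Prop where
  contDiff : ContDiff ℝ 2 τ
  hasCompactSupport : HasCompactSupport τ
  mem_iff : ∀ z, z ∈ Ω ↔ 0 < τ z
  fderiv_ne_zero : ∀ x ∈ frontier Ω, fderiv ℝ τ x ≠ 0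

/-! ### Laplacian and gradient of the defining function -/

/-- The Euclidean Laplacian on `ℂⁿ`. -/
noncomputable def coordLaplacian {n : ℕ} (χ : CSpace n → ℝ) (z : CSpace n) : ℝ :=
  ∑ j : Fin n, lineLaplacian χ (EuclideanSpace.single j 1) z

/-- The squared Euclidean norm of the real gradient. -/
noncomputable def gradSq {n : ℕ} (τ : CSpace n → ℝ) (z : CSpace n) : ℝ :=
  ∑ j : Fin n, (fderiv ℝ τ z (EuclideanSpace.single j 1) ^ 2 +
    fderiv ℝ τ z (Complex.I • EuclideanSpace.single j 1) ^ 2)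

theorem DiscSubmean.integral_coordLaplacian_nonneg {n : ℕ} {Ω : Set (CSpace n)} (hΩ : IsOpen Ω)
    {w : CSpace n → ℝ} (hw : DiscSubmean Ω w) {χ : CSpace n → ℝ} (hχ : ContDiff ℝ 2 χ)
    (hχ0 : ∀ z, 0 ≤ χ z) (hχs : HasCompactSupport χ) (hχΩ : tsupport χ ⊆ Ω)
    (hint : ∀ ξ, Integrable fun z => w z * lineLaplacian χ ξ z) :
    0 ≤ ∫ z, w z * coordLaplacian χ z := by
  simp only [coordLaplacian, Finset.mul_sum]
  rw [integral_finsetSum _ fun j _ => hint _]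
  exact Finset.sum_nonneg fun j _ => hw.integral_lineLaplacian_nonneg hΩ hχ hχ0 hχs hχΩ _

theorem gradSq_nonneg {n : ℕ} (τ : CSpace n → ℝ) (z : CSpace n) : 0 ≤ gradSq τ z :=
  Finset.sum_nonneg fun _ _ => by positivity

theorem fderiv_eq_zero_of_gradSq {n : ℕ} {τ : CSpace n → ℝ} {z : CSpace n} (h : gradSq τ z = 0) :
    fderiv ℝ τ z = 0 := by
  have h1 := (Finset.sum_eq_zero_iff_of_nonneg fun j _ => by positivity).1 h
  ext v
  have hv : v = ∑ j : Fin n, ((v j).re • EuclideanSpace.single j (1 : ℂ) +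
      (v j).im • (Complex.I • EuclideanSpace.single j (1 : ℂ))) := by
    ext i
    simp [Pi.single_apply, Finset.sum_add_distrib, Complex.re_add_im]
  rw [hv, map_sum]
  refine Finset.sum_eq_zero fun j hj => ?_
  have h2 := h1 j hj
  have a : fderiv ℝ τ z (EuclideanSpace.single j 1) = 0 := by nlinarith
  have b : fderiv ℝ τ z (Complex.I • EuclideanSpace.single j 1) = 0 := by nlinarith
  rw [map_add, map_smul, map_smul, a, b]
  simp

theorem continuous_fderiv_fderiv_apply {E : Type*} [NormedAddCommGroup E] [NormedSpace ℝ E]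
    {χ : E → ℝ} (hχ : ContDiff ℝ 2 χ) (u v : E) :
    Continuous fun z => fderiv ℝ (fderiv ℝ χ) z u v := by
  have h1 : ContDiff ℝ 1 (fderiv ℝ χ) := hχ.fderiv_right (by norm_num)
  have h2 : Continuous (fderiv ℝ (fderiv ℝ χ)) := h1.continuous_fderiv (by norm_num)
  exact (h2.clm_apply continuous_const).clm_apply continuous_const

theorem continuous_lineLaplacian {n : ℕ} {χ : CSpace n → ℝ} (hχ : ContDiff ℝ 2 χ) (ξ : CSpace n) :
    Continuous (lineLaplacian χ ξ) :=
  (continuous_fderiv_fderiv_apply hχ _ _).add (continuous_fderiv_fderiv_apply hχ _ _)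

theorem continuous_coordLaplacian {n : ℕ} {χ : CSpace n → ℝ} (hχ : ContDiff ℝ 2 χ) :
    Continuous (coordLaplacian χ) :=
  continuous_finsetSum _ fun _ _ => continuous_lineLaplacian hχ _

theorem continuous_gradSq {n : ℕ} {τ : CSpace n → ℝ} (hτ : ContDiff ℝ 2 τ) :
    Continuous (gradSq τ) := by
  have h : Continuous (fderiv ℝ τ) := hτ.continuous_fderiv (by norm_num)
  exact continuous_finsetSum _ fun _ _ =>
    ((h.clm_apply continuous_const).pow 2).add ((h.clm_apply continuous_const).pow 2)

/-- The maximum of |∇τ|² and τ is positive on the compact closure: τ is positive inside and ∇τ does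
not vanish on the boundary. Its minimum serves as c. -/
theorem IsDefiningFunction.exists_gradSq_lower_bound {n : ℕ} {Ω : Set (CSpace n)}
    {τ : CSpace n → ℝ} (hτ : IsDefiningFunction Ω τ) (hΩ : IsBoundedDomain Ω) :
    ∃ c > 0, ∀ z ∈ closure Ω, τ z < c → c ≤ gradSq τ z := by
  have hK : IsCompact (closure Ω) :=
    Metric.isCompact_of_isClosed_isBounded isClosed_closure hΩ.isBounded.closure
  obtain ⟨x, hx, hmin⟩ := hK.exists_isMinOn hΩ.isConnected.nonempty.closure
    ((continuous_gradSq hτ.contDiff).max hτ.contDiff.continuous).continuousOn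
  refine ⟨max (gradSq τ x) (τ x), ?_, fun z hz hzc => ?_⟩
  · by_cases hxΩ : x ∈ Ω
    · exact lt_max_of_lt_right ((hτ.mem_iff x).1 hxΩ)
    · have hxf : x ∈ frontier Ω := by
        rw [hΩ.isOpen.frontier_eq]; exact ⟨hx, hxΩ⟩
      refine lt_max_of_lt_left (lt_of_le_of_ne (gradSq_nonneg τ x) fun h => ?_)
      exact hτ.fderiv_ne_zero x hxf (fderiv_eq_zero_of_gradSq h.symm)
  · have h1 : max (gradSq τ x) (τ x) ≤ max (gradSq τ z) (τ z) := hmin hz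
    rcases le_max_iff.1 h1 with h | h
    · exact h
    · exact absurd hzc (not_lt.2 h)

theorem fderiv_fderiv_comp {E : Type*} [NormedAddCommGroup E] [NormedSpace ℝ E]
    {τ : E → ℝ} (hτ : ContDiff ℝ 2 τ) {h k : ℝ → ℝ} {k' : ℝ} (hh : ∀ s, HasDerivAt h (k s) s)
    {z : E} (hk : HasDerivAt k k' (τ z)) (v : E) :
    fderiv ℝ (fderiv ℝ fun y => h (τ y)) z v v =
      k' * fderiv ℝ τ z v ^ 2 + k (τ z) * fderiv ℝ (fderiv ℝ τ) z v v := by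
  have hd : Differentiable ℝ τ := hτ.differentiable (by norm_num)
  have h1 : ContDiff ℝ 1 (fderiv ℝ τ) := hτ.fderiv_right (by norm_num)
  have e : (fderiv ℝ fun y => h (τ y)) = fun y => k (τ y) • fderiv ℝ τ y := by
    ext1 y
    exact ((hh (τ y)).comp_hasFDerivAt y (hd y).hasFDerivAt).fderiv
  rw [e]
  have hk1 : HasFDerivAt (fun y => k (τ y)) (k' • fderiv ℝ τ z) z :=
    hk.comp_hasFDerivAt z (hd z).hasFDerivAt
  have h2 := hk1.smul (h1.differentiable (by norm_num) z).hasFDerivAt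
  have h3 : fderiv ℝ (fun y => k (τ y) • fderiv ℝ τ y) z = _ := h2.fderiv
  rw [h3]
  simp
  ring

theorem coordLaplacian_comp {n : ℕ} {τ : CSpace n → ℝ} (hτ : ContDiff ℝ 2 τ) {h k : ℝ → ℝ} {k' : ℝ}
    (hh : ∀ s, HasDerivAt h (k s) s) {z : CSpace n} (hk : HasDerivAt k k' (τ z)) :
    coordLaplacian (fun y => h (τ y)) z =
      k' * gradSq τ z + k (τ z) * coordLaplacian τ z := by
  simp only [coordLaplacian, gradSq, lineLaplacian, Finset.mul_sum, ← Finset.sum_add_distrib]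
  refine Finset.sum_congr rfl fun j _ => ?_
  rw [fderiv_fderiv_comp hτ hh hk, fderiv_fderiv_comp hτ hh hk]
  ring

/-! ### Test functions and comparison of shells -/

theorem hasDerivAt_posPart_sq (x : ℝ) : HasDerivAt (fun x : ℝ => max x 0 ^ 2) (2 * max x 0) x := by
  rcases lt_trichotomy x 0 with h | h | h
  · have : (fun x : ℝ => max x 0 ^ 2) =ᶠ[𝓝 x] fun _ => 0 := by
      filter_upwards [Iio_mem_nhds h] with y hy
      have hy : y < 0 := hy
      simp [max_eq_right hy.le]
    rw [max_eq_right h.le, mul_zero]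
    exact (hasDerivAt_const x (0:ℝ)).congr_of_eventuallyEq this
  · subst h
    rw [hasDerivAt_iff_isLittleO_nhds_zero]
    simp only [zero_add, max_self, mul_zero, smul_zero, sub_zero, ne_eq, OfNat.ofNat_ne_zero,
      not_false_eq_true, zero_pow]
    have : (fun x : ℝ => max x 0 ^ 2) =O[𝓝 0] fun x => x ^ 2 := by
      refine Asymptotics.IsBigO.of_bound 1 (Filter.Eventually.of_forall fun x => ?_)
      rw [Real.norm_of_nonneg (by positivity), Real.norm_of_nonneg (by positivity), one_mul]
      rcases le_total x 0 with h | h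
      · rw [max_eq_right h]; nlinarith
      · rw [max_eq_left h]
    exact this.trans_isLittleO (by simpa using Asymptotics.isLittleO_pow_id (𝕜 := ℝ) one_lt_two)
  · have : (fun x : ℝ => max x 0 ^ 2) =ᶠ[𝓝 x] fun x => x ^ 2 := by
      filter_upwards [Ioi_mem_nhds h] with y hy
      have hy : 0 < y := hy
      simp [max_eq_left hy.le]
    rw [max_eq_left h.le]
    simpa using (hasDerivAt_pow 2 x).congr_of_eventuallyEq this

/-- The radial profile used to compare shells of different thickness. -/
theorem exists_shell_profile : ∃ M > 0, ∀ a b : ℝ, 0 < a → a ≤ b → ∃ j j' : ℝ → ℝ,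
    (∀ s, HasDerivAt j (j' s) s) ∧ Continuous j' ∧ (∀ s, 0 ≤ j s) ∧
    (∀ s ≤ a / 2, j s = 0 ∧ j' s = 0) ∧ (∀ s, 2 * b ≤ s → j s = 0 ∧ j' s = 0) ∧
    (∀ s, 0 ≤ s → j' s ≤ M / a) ∧ (∀ s, a ≤ s → j' s ≤ 0) ∧
    (∀ s, a ≤ s → s < b → j' s ≤ -(2 / b)) := by
  set T := Real.smoothTransition
  have hTd : ∀ x, HasDerivAt T (deriv T x) x := fun x =>
    ((Real.smoothTransition.contDiff (n := 1)).differentiable (by norm_num) x).hasDerivAt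
  have hTc : Continuous (deriv T) :=
    (Real.smoothTransition.contDiff (n := 1)).continuous_deriv (by norm_num)
  have hT1 : ∀ x, 1 ≤ x → deriv T x = 0 := fun x hx =>
    IsLocalMax.deriv_eq_zero (Filter.Eventually.of_forall fun y => (Real.smoothTransition.le_one y).trans_eq
      (Real.smoothTransition.one_of_one_le hx).symm)
  have hT0 : ∀ x, x ≤ 0 → deriv T x = 0 := fun x hx =>
    IsLocalMin.deriv_eq_zero (Filter.Eventually.of_forall fun y => (Real.smoothTransition.zero_of_nonpos hx).trans_le
      (Real.smoothTransition.nonneg y))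
  obtain ⟨M, hM⟩ := (isCompact_Icc (a := (0:ℝ)) (b := 1)).exists_bound_of_continuousOn
    hTc.continuousOn
  have hMT : ∀ x, deriv T x ≤ M := fun x => by
    have h0 : 0 ≤ M := (norm_nonneg _).trans (hM 0 (by simp))
    by_cases hx : x ∈ Set.Icc (0:ℝ) 1
    · exact (le_abs_self _).trans (hM x hx)
    · rcases lt_or_ge x 0 with h | h
      · rw [hT0 x h.le]; exact h0
      · rw [hT1 x (not_le.1 fun h' => hx ⟨h, h'⟩).le]; exact h0
  have hM0 : 0 ≤ M := (norm_nonneg _).trans (hM 0 (by simp))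
  -- The constant collects the bound M + 1 for the slope of T, the chain-rule factor 2/a and the
  -- bound 4 for P².
  refine ⟨8 * (M + 1), by positivity, fun a b ha hab => ?_⟩
  have hb : 0 < b := ha.trans_le hab
  -- The profile is T(2s/a - 1) P(s)². The first factor switches on between a/2 and a. The second is
  -- C¹, vanishes beyond 2b, and decreases with slope at most -2/b before b, where P ≥ 1.
  let P : ℝ → ℝ := fun s => max (2 - s / b) 0
  have hP0 : ∀ s, 0 ≤ P s := fun s => le_max_right _ _
  have hA : ∀ s, HasDerivAt (fun s => T (2 * s / a - 1)) (deriv T (2 * s / a - 1) * (2 / a)) s :=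
    fun s => by
      have : HasDerivAt (fun s => 2 * s / a - 1) (2 / a) s := by
        simpa using (((hasDerivAt_id s).const_mul 2).div_const a).sub_const 1
      exact (hTd _).comp s this
  have hB : ∀ s, HasDerivAt (fun s => P s ^ 2) (2 * P s * (-(1 / b))) s := fun s => by
    have : HasDerivAt (fun s => 2 - s / b) (-(1 / b)) s := by
      simpa using ((hasDerivAt_id s).div_const b).const_sub 2
    exact (hasDerivAt_posPart_sq _).comp s this
  have hTge : ∀ s, a ≤ s → T (2 * s / a - 1) = 1 ∧ deriv T (2 * s / a - 1) = 0 := fun s hs => by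
    have : 1 ≤ 2 * s / a - 1 := by
      have : 2 ≤ 2 * s / a := by rw [le_div_iff₀ ha]; linarith
      linarith
    exact ⟨Real.smoothTransition.one_of_one_le this, hT1 _ this⟩
  have hTle : ∀ s, s ≤ a / 2 → T (2 * s / a - 1) = 0 ∧ deriv T (2 * s / a - 1) = 0 := fun s hs => by
    have : 2 * s / a - 1 ≤ 0 := by
      have : 2 * s / a ≤ 1 := by rw [div_le_iff₀ ha]; linarith
      linarith
    exact ⟨Real.smoothTransition.zero_of_nonpos this, hT0 _ this⟩
  have hPge : ∀ s, 2 * b ≤ s → P s = 0 := fun s hs => by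
    apply max_eq_right
    have : 2 ≤ s / b := by rw [le_div_iff₀ hb]; linarith
    linarith
  refine ⟨fun s => T (2 * s / a - 1) * P s ^ 2,
    fun s => deriv T (2 * s / a - 1) * (2 / a) * P s ^ 2 +
      T (2 * s / a - 1) * (2 * P s * (-(1 / b))), fun s => (hA s).mul (hB s), ?_, ?_, ?_, ?_,
      ?_, ?_, ?_⟩
  · have hTc' : Continuous T := Real.smoothTransition.continuous
    have hPc : Continuous P := by fun_prop
    have e : Continuous fun s : ℝ => 2 * s / a - 1 := by fun_prop
    exact (((hTc.comp e).mul continuous_const).mul (hPc.pow 2)).add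
      ((hTc'.comp e).mul ((continuous_const.mul hPc).mul continuous_const))
  · intro s
    exact mul_nonneg (Real.smoothTransition.nonneg _) (by positivity)
  · intro s hs
    simp [(hTle s hs).1, (hTle s hs).2]
  · intro s hs
    simp [hPge s hs]
  · intro s hs
    have h2 : P s ≤ 2 := max_le (by have : 0 ≤ s / b := by positivity
                                    linarith) (by norm_num)
    have h3 : 0 ≤ T (2 * s / a - 1) * (2 * P s * (1 / b)) :=
      mul_nonneg (Real.smoothTransition.nonneg _) (by have := hP0 s; positivity)
    have h4 : P s ^ 2 ≤ 4 := by nlinarith [hP0 s]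
    have h5 : deriv T (2 * s / a - 1) * (2 / a) * P s ^ 2 ≤ (M + 1) * (2 / a) * 4 := by
      have : deriv T (2 * s / a - 1) ≤ M + 1 := by linarith [hMT (2 * s / a - 1)]
      calc _ ≤ (M + 1) * (2 / a) * P s ^ 2 := by gcongr
        _ ≤ _ := by gcongr
    have h6 : (M + 1) * (2 / a) * 4 = 8 * (M + 1) / a := by ring
    simp only
    linarith
  · intro s hs
    simp only [(hTge s hs).1, (hTge s hs).2]
    have : 0 ≤ 2 * P s * (1 / b) := by have := hP0 s; positivity
    linarith
  · intro s hs hsb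
    simp only [(hTge s hs).1, (hTge s hs).2]
    have h1 : 1 ≤ P s := le_max_of_le_left (by
      have : s / b ≤ 1 := by rw [div_le_iff₀ hb]; linarith
      linarith)
    have : 2 * 1 * (1 / b) ≤ 2 * P s * (1 / b) := by gcongr
    have e : 2 / b = 2 * 1 * (1 / b) := by ring
    rw [e]
    linarith

/-- The mass of `w` in the shell `{0 < τ < b}`. -/
noncomputable def shellMass {n : ℕ} (τ w : CSpace n → ℝ) (b : ℝ) : ℝ≥0∞ :=
  ∫⁻ z in {z | 0 < τ z ∧ τ z < b}, ENNReal.ofReal (w z)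

/-- Take χ = h(τ) with h' = e^{-κs} j(s), j the shell profile. In Δχ = h''(τ)|∇τ|² + h'(τ)Δτ the
last term has no sign. The exponential weight absorbs it once Δτ ≤ κ|∇τ|², leaving the sign of j'.
-/
theorem exists_shell_test_function {n : ℕ} {Ω : Set (CSpace n)} (hΩ : IsBoundedDomain Ω)
    {τ : CSpace n → ℝ} (hτ : IsDefiningFunction Ω τ) :
    ∃ c₀ C₁ c₂ : ℝ, 0 < c₀ ∧ 0 < C₁ ∧ 0 < c₂ ∧ ∀ a b : ℝ, 0 < a → a ≤ b → b ≤ c₀ →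
      ∃ χ : CSpace n → ℝ, ContDiff ℝ 2 χ ∧ (∀ z, 0 ≤ χ z) ∧ tsupport χ ⊆ {z | a / 2 ≤ τ z} ∧
        (∀ z, τ z < a / 2 → coordLaplacian χ z = 0) ∧
        (∀ z, 0 < τ z → coordLaplacian χ z ≤ C₁ / a) ∧
        (∀ z, a ≤ τ z → coordLaplacian χ z ≤ 0) ∧
        (∀ z, a ≤ τ z → τ z < b → coordLaplacian χ z ≤ -(c₂ / b)) := by
  obtain ⟨c, hc, hgrad⟩ := hτ.exists_gradSq_lower_bound hΩ
  have hK : IsCompact (closure Ω) :=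
    Metric.isCompact_of_isClosed_isBounded isClosed_closure hΩ.isBounded.closure
  obtain ⟨G, hG⟩ := hK.exists_bound_of_continuousOn (continuous_gradSq hτ.contDiff).continuousOn
  obtain ⟨L, hL⟩ := hK.exists_bound_of_continuousOn
    (continuous_coordLaplacian hτ.contDiff).continuousOn
  obtain ⟨M, hM, hprof⟩ := exists_shell_profile
  obtain ⟨x₀, hx₀⟩ := hΩ.isConnected.nonempty
  have hG0 : 0 ≤ G := (norm_nonneg _).trans (hG x₀ (subset_closure hx₀))
  have hL0 : 0 ≤ L := (norm_nonneg _).trans (hL x₀ (subset_closure hx₀))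
  -- L bounds |Δτ| and c bounds |∇τ|² from below near the boundary, so κ|∇τ|² ≥ L ≥ Δτ there.
  set κ := L / c with hκ
  have hκ0 : 0 ≤ κ := by positivity
  -- With b ≤ c/2 the profile is supported in s ≤ 2b ≤ c, where the gradient bound holds; deeper
  -- inside, h is constant.
  refine ⟨c / 2, M * (G + 1), 2 * c * Real.exp (-(κ * c)), by positivity, by positivity,
    by positivity, fun a b ha hab hbc => ?_⟩
  have hb : 0 < b := ha.trans_le hab
  obtain ⟨j, j', hj, hj'c, hj0, hjle, hjge, hj'M, hj'neg, hj'b⟩ := hprof a b ha hab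
  let k : ℝ → ℝ := fun s => Real.exp (-(κ * s)) * j s
  let k' : ℝ → ℝ := fun s => Real.exp (-(κ * s)) * (j' s - κ * j s)
  have hk : ∀ s, HasDerivAt k (k' s) s := fun s => by
    have h1 : HasDerivAt (fun s => Real.exp (-(κ * s))) (Real.exp (-(κ * s)) * (-κ)) s := by
      have : HasDerivAt (fun s => -(κ * s)) (-κ) s := by
        simpa using ((hasDerivAt_id s).const_mul κ).fun_neg
      exact this.exp
    convert! h1.mul (hj s) using 1
    simp only [k']; ring
  have hjc : Continuous j := continuous_iff_continuousAt.2 fun s => (hj s).continuousAt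
  have hkc : Continuous k := continuous_iff_continuousAt.2 fun s => (hk s).continuousAt
  have hk'c : Continuous k' := by fun_prop
  have hk0 : ∀ s, 0 ≤ k s := fun s => mul_nonneg (Real.exp_pos _).le (hj0 s)
  let h : ℝ → ℝ := fun s => ∫ u in (0 : ℝ)..s, k u
  have hh : ∀ s, HasDerivAt h (k s) s := fun s => (hkc.integral_hasStrictDerivAt 0 s).hasDerivAt
  have hhle : ∀ s ≤ a / 2, h s = 0 := fun s hs => by
    have : ∀ u ∈ Set.uIcc 0 s, k u = 0 := fun u hu => by
      have : u ≤ a / 2 := hu.2.trans (max_le (by positivity) hs)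
      simp [k, (hjle u this).1]
    simp only [h]
    rw [intervalIntegral.integral_congr this]
    simp
  have hh0 : ∀ s, 0 ≤ h s := fun s => by
    rcases le_total s (a / 2) with hs | hs
    · rw [hhle s hs]
    · exact intervalIntegral.integral_nonneg (by linarith) fun u _ => hk0 u
  have hkC : ContDiff ℝ 1 k := by
    rw [contDiff_one_iff_deriv]
    refine ⟨fun s => (hk s).differentiableAt, ?_⟩
    rwa [show deriv k = k' from funext fun s => (hk s).deriv]
  have hhC : ContDiff ℝ 2 h := by
    rw [show (2 : WithTop ℕ∞) = 1 + 1 by norm_num, contDiff_succ_iff_deriv]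
    refine ⟨fun s => (hh s).differentiableAt, by simp, ?_⟩
    rwa [show deriv h = k from funext fun s => (hh s).deriv]
  have hlap : ∀ z, coordLaplacian (fun y => h (τ y)) z =
      k' (τ z) * gradSq τ z + k (τ z) * coordLaplacian τ z := fun z =>
    coordLaplacian_comp hτ.contDiff hh (hk _)
  have hzero : ∀ z, (j (τ z) = 0 ∧ j' (τ z) = 0) → coordLaplacian (fun y => h (τ y)) z = 0 :=
    fun z hz => by rw [hlap]; simp [k, k', hz.1, hz.2]
  have hmain : ∀ z, 0 < τ z → τ z < c → coordLaplacian (fun y => h (τ y)) z ≤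
      Real.exp (-(κ * τ z)) * (j' (τ z) * gradSq τ z) := by
    intro z hz hzc
    have hzΩ : z ∈ closure Ω := subset_closure ((hτ.mem_iff z).2 hz)
    have h1 := hgrad z hzΩ hzc
    have h2 : coordLaplacian τ z ≤ κ * gradSq τ z := by
      have := (le_abs_self _).trans (hL z hzΩ)
      have h3 : κ * c = L := div_mul_cancel₀ _ hc.ne'
      nlinarith
    rw [hlap]
    have h4 : k (τ z) * coordLaplacian τ z ≤ k (τ z) * (κ * gradSq τ z) :=
      mul_le_mul_of_nonneg_left h2 (hk0 _)
    have h5 : k' (τ z) * gradSq τ z + k (τ z) * (κ * gradSq τ z) =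
        Real.exp (-(κ * τ z)) * (j' (τ z) * gradSq τ z) := by
      simp only [k, k']; ring
    linarith
  have hexp1 : ∀ z, 0 < τ z → Real.exp (-(κ * τ z)) ≤ 1 := fun z hz => by
    rw [Real.exp_le_one_iff]
    have : 0 ≤ κ * τ z := by positivity
    linarith
  have hnonpos : ∀ z, a ≤ τ z → coordLaplacian (fun y => h (τ y)) z ≤ 0 := by
    intro z hz
    rcases le_or_gt (2 * b) (τ z) with hzb | hzb
    · rw [hzero z (hjge _ hzb)]
    · refine (hmain z (ha.trans_le hz) (by linarith)).trans ?_
      exact mul_nonpos_of_nonneg_of_nonpos (Real.exp_pos _).le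
        (mul_nonpos_of_nonpos_of_nonneg (hj'neg _ hz) (gradSq_nonneg _ _))
  refine ⟨fun y => h (τ y), hhC.comp hτ.contDiff, fun z => hh0 _, ?_, ?_, ?_, hnonpos, ?_⟩
  · refine closure_minimal (fun z hz => ?_) (isClosed_le continuous_const hτ.contDiff.continuous)
    by_contra hlt
    exact hz (hhle _ (not_le.1 hlt).le)
  · exact fun z hz => hzero z (hjle _ hz.le)
  · intro z hz
    have hpos : 0 ≤ M * (G + 1) / a := by positivity
    rcases le_or_gt (2 * b) (τ z) with hzb | hzb
    · rw [hzero z (hjge _ hzb)]; exact hpos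
    refine (hmain z hz (by linarith)).trans ?_
    have hg : gradSq τ z ≤ G + 1 := by
      have := (le_abs_self _).trans (hG z (subset_closure ((hτ.mem_iff z).2 hz)))
      linarith
    have h1 : j' (τ z) * gradSq τ z ≤ M * (G + 1) / a := by
      calc j' (τ z) * gradSq τ z ≤ M / a * gradSq τ z :=
            mul_le_mul_of_nonneg_right (hj'M _ hz.le) (gradSq_nonneg _ _)
        _ ≤ M / a * (G + 1) := by gcongr
        _ = _ := by ring
    calc _ ≤ Real.exp (-(κ * τ z)) * (M * (G + 1) / a) := by gcongr
      _ ≤ 1 * (M * (G + 1) / a) := by gcongr; exact hexp1 z hz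
      _ = _ := one_mul _
  · intro z hz hzb
    have hzpos := ha.trans_le hz
    refine (hmain z hzpos (by linarith)).trans ?_
    have h1 : j' (τ z) * gradSq τ z ≤ -(2 / b * c) := by
      have e1 := hj'b _ hz hzb
      have e2 := hgrad z (subset_closure ((hτ.mem_iff z).2 hzpos)) (by linarith)
      have e3 : 0 < 2 / b := by positivity
      nlinarith
    have h2 : Real.exp (-(κ * c)) ≤ Real.exp (-(κ * τ z)) := by
      apply Real.exp_le_exp.2
      have : κ * τ z ≤ κ * c := by gcongr; linarith
      linarith
    have h3 : 0 ≤ 2 / b * c := by positivity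
    calc _ ≤ Real.exp (-(κ * τ z)) * -(2 / b * c) := by gcongr
      _ ≤ Real.exp (-(κ * c)) * -(2 / b * c) := by nlinarith
      _ = _ := by ring

theorem DiscSubmean.integrable_mul {n : ℕ} {Ω : Set (CSpace n)} {w : CSpace n → ℝ}
    (hw : DiscSubmean Ω w) {g : CSpace n → ℝ} (hg : Continuous g) {K : Set (CSpace n)}
    (hK : IsCompact K) (hKΩ : K ⊆ Ω) (hgK : ∀ z ∉ K, g z = 0) :
    Integrable fun z => w z * g z := by
  rw [← integrableOn_iff_integrable_of_support_subset (s := K)]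
  · exact ((hw.continuousOn.mono hKΩ).mul hg.continuousOn).integrableOn_compact hK
  · intro z hz
    by_contra h
    exact hz (by simp [hgK z h])

/-- Pairing w with Δχ ≥ 0 in the sense of distributions balances a source of strength C₁/a on {a/2 ≤
τ < a} against a sink of strength c₂/b on {a ≤ τ < b}. The mass of w on the outer part of the
estimate, {τ < a}, therefore controls its mass further inside. -/
theorem exists_shellMass_comparison {n : ℕ} {Ω : Set (CSpace n)} (hΩ : IsBoundedDomain Ω)
    {τ : CSpace n → ℝ} (hτ : IsDefiningFunction Ω τ) :
    ∃ c₀ C : ℝ, 0 < c₀ ∧ 0 < C ∧ ∀ w, DiscSubmean Ω w → ∀ a b : ℝ, 0 < a → a ≤ b → b ≤ c₀ →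
      ENNReal.ofReal a * shellMass τ w b ≤ ENNReal.ofReal (C * b) * shellMass τ w a := by
  obtain ⟨c₀, C₁, c₂, hc₀, hC₁, hc₂, htest⟩ := exists_shell_test_function hΩ hτ
  refine ⟨c₀, 1 + C₁ / c₂, hc₀, by positivity, fun w hw a b ha hab hbc => ?_⟩
  have hb : 0 < b := ha.trans_le hab
  obtain ⟨χ, hχ, hχ0, hχs, hz, hup, hneg, hlow⟩ := htest a b ha hab hbc
  have hτc := hτ.contDiff.continuous
  have hKm : MeasurableSet {z | a / 2 ≤ τ z} := (isClosed_le continuous_const hτc).measurableSet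
  have hKΩ : {z | a / 2 ≤ τ z} ⊆ Ω := fun z hz => (hτ.mem_iff z).2 (lt_of_lt_of_le (by positivity) hz)
  have hKc : IsCompact {z | a / 2 ≤ τ z} := Metric.isCompact_of_isClosed_isBounded
    (isClosed_le continuous_const hτc) (hΩ.isBounded.subset hKΩ)
  have hχc : HasCompactSupport χ := hKc.of_isClosed_subset (isClosed_tsupport _) hχs
  have hnn := hw.integral_coordLaplacian_nonneg hΩ.isOpen hχ hχ0 hχc (hχs.trans hKΩ) fun ξ =>
    hw.integrable_mul (continuous_lineLaplacian hχ ξ) hχc (hχs.trans hKΩ) fun z hz => by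
      simp [lineLaplacian, fderiv_fderiv_eq_zero hz]
  set P : Set (CSpace n) := {z | a / 2 ≤ τ z ∧ τ z < a} with hP
  set Q : Set (CSpace n) := {z | a ≤ τ z ∧ τ z < b} with hQ
  have hPm : MeasurableSet P := hKm.inter (isOpen_lt hτc continuous_const).measurableSet
  have hQm : MeasurableSet Q :=
    (isClosed_le continuous_const hτc).measurableSet.inter
      (isOpen_lt hτc continuous_const).measurableSet
  have hwK : IntegrableOn w {z | a / 2 ≤ τ z} := (hw.continuousOn.mono hKΩ).integrableOn_compact hKc
  have hwP : IntegrableOn w P := hwK.mono_set fun z hz => hz.1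
  have hwQ : IntegrableOn w Q := hwK.mono_set fun z hz => by
    have : a ≤ τ z := hz.1
    change a / 2 ≤ τ z
    linarith
  have hle : ∫ z, w z * coordLaplacian χ z ≤
      ∫ z, (C₁ / a * P.indicator w z - c₂ / b * Q.indicator w z) := by
    refine integral_mono ?_ ?_ fun z => ?_
    · exact hw.integrable_mul (continuous_coordLaplacian hχ) hKc hKΩ fun z hz' =>
        hz z (not_le.1 hz')
    · exact (((integrable_indicator_iff hPm).2 hwP).const_mul _).sub
        (((integrable_indicator_iff hQm).2 hwQ).const_mul _)
    · simp only
      have hw0 := hw.nonneg z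
      rcases lt_or_ge (τ z) (a / 2) with h1 | h1
      · have hnP : z ∉ P := fun h => absurd h.1 (not_le.2 h1)
        have hnQ : z ∉ Q := fun h => by have : a ≤ τ z := h.1; linarith
        simp [hz z h1, hnP, hnQ]
      rcases lt_or_ge (τ z) a with h2 | h2
      · have hPz : z ∈ P := ⟨h1, h2⟩
        have hnQ : z ∉ Q := fun h => absurd h.1 (not_le.2 h2)
        simp only [Set.indicator_of_mem hPz, Set.indicator_of_notMem hnQ, mul_zero, sub_zero]
        rw [mul_comm]
        exact mul_le_mul_of_nonneg_right (hup z (by linarith)) hw0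
      have hnP : z ∉ P := fun h => absurd h.2 (not_lt.2 h2)
      rcases lt_or_ge (τ z) b with h3 | h3
      · have hQz : z ∈ Q := ⟨h2, h3⟩
        simp only [Set.indicator_of_mem hQz, Set.indicator_of_notMem hnP, mul_zero, zero_sub]
        rw [mul_comm, ← neg_mul]
        exact mul_le_mul_of_nonneg_right (hlow z h2 h3) hw0
      · have hnQ : z ∉ Q := fun h => absurd h.2 (not_lt.2 h3)
        simp only [Set.indicator_of_notMem hnQ, Set.indicator_of_notMem hnP, mul_zero, sub_zero]
        exact mul_nonpos_of_nonneg_of_nonpos hw0 (hneg z h2)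
  rw [integral_sub (((integrable_indicator_iff hPm).2 hwP).const_mul _)
    (((integrable_indicator_iff hQm).2 hwQ).const_mul _), integral_const_mul, integral_const_mul,
    integral_indicator hPm, integral_indicator hQm] at hle
  have hQP : a * ∫ z in Q, w z ≤ C₁ / c₂ * b * ∫ z in P, w z := by
    have h1 : c₂ / b * ∫ z in Q, w z ≤ C₁ / a * ∫ z in P, w z := by linarith
    have h2 := mul_le_mul_of_nonneg_left h1 (by positivity : 0 ≤ a * b / c₂)
    have e1 : a * b / c₂ * (c₂ / b * ∫ z in Q, w z) = a * ∫ z in Q, w z := by field_simp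
    have e2 : a * b / c₂ * (C₁ / a * ∫ z in P, w z) = C₁ / c₂ * b * ∫ z in P, w z := by field_simp
    rwa [e1, e2] at h2
  have hQP' : ENNReal.ofReal a * ∫⁻ z in Q, ENNReal.ofReal (w z) ≤
      ENNReal.ofReal (C₁ / c₂ * b) * ∫⁻ z in P, ENNReal.ofReal (w z) := by
    rw [← ofReal_integral_eq_lintegral_ofReal hwQ (ae_of_all _ hw.nonneg),
      ← ofReal_integral_eq_lintegral_ofReal hwP (ae_of_all _ hw.nonneg),
      ← ENNReal.ofReal_mul ha.le, ← ENNReal.ofReal_mul (by positivity)]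
    exact ENNReal.ofReal_le_ofReal hQP
  have hPS : ∫⁻ z in P, ENNReal.ofReal (w z) ≤ shellMass τ w a :=
    lintegral_mono_set fun z hz => ⟨lt_of_lt_of_le (by positivity) hz.1, hz.2⟩
  have hSb : shellMass τ w b ≤ shellMass τ w a + ∫⁻ z in Q, ENNReal.ofReal (w z) := by
    refine (lintegral_mono_set fun z hz => ?_).trans (lintegral_union_le _ _ _)
    rcases lt_or_ge (τ z) a with h | h
    · exact Or.inl ⟨hz.1, h⟩
    · exact Or.inr ⟨h, hz.2⟩
  calc ENNReal.ofReal a * shellMass τ w b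
      ≤ ENNReal.ofReal a * shellMass τ w a +
          ENNReal.ofReal a * ∫⁻ z in Q, ENNReal.ofReal (w z) := by
        rw [← mul_add]; gcongr
    _ ≤ ENNReal.ofReal b * shellMass τ w a + ENNReal.ofReal (C₁ / c₂ * b) * shellMass τ w a := by
        refine add_le_add ?_ (hQP'.trans ?_)
        · gcongr
        · gcongr
    _ = _ := by
        rw [← add_mul, ← ENNReal.ofReal_add hb.le (by positivity)]
        congr 2
        ring

/-! ### Anisotropic polydiscs and the pointwise bound -/

theorem exists_volume_polydisc (n : ℕ) : ∃ c : ℝ≥0, 0 < c ∧ ∀ r : Fin n → ℝ,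
    volume {v : CSpace n | ∀ j, ‖v j‖ < r j} = c * ∏ j, (ENNReal.ofReal (r j) ^ 2 * NNReal.pi) := by
  let L : CSpace n ≃L[ℝ] (Fin n → ℂ) := PiLp.continuousLinearEquiv 2 ℝ fun _ : Fin n => ℂ
  have hH : (Measure.map L (volume : Measure (CSpace n))).IsAddHaarMeasure :=
    L.isAddHaarMeasure_map volume
  obtain ⟨c, hc, h1⟩ : ∃ c : ℝ≥0, 0 < c ∧
      Measure.map L (volume : Measure (CSpace n)) = c • volume :=
    ⟨_, Measure.addHaarScalarFactor_pos_of_isAddHaarMeasure _ _,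
      Measure.isAddLeftInvariant_eq_smul _ _⟩
  refine ⟨c, hc, fun r => ?_⟩
  have h2 : {v : CSpace n | ∀ j, ‖v j‖ < r j} =
      L ⁻¹' (Set.univ.pi fun j => Metric.ball (0 : ℂ) (r j)) := by
    ext v; simp [L]
  have hm : MeasurableSet (Set.univ.pi fun j : Fin n => Metric.ball (0 : ℂ) (r j)) :=
    MeasurableSet.univ_pi fun j => measurableSet_ball
  rw [h2, ← Measure.map_apply L.continuous.measurable hm, h1, Measure.smul_apply, volume_pi_pi]
  simp only [Complex.volume_ball]
  rfl

theorem re_inner_eq {n : ℕ} (x y : CSpace n) : inner ℝ x y = (inner ℂ x y).re := by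
  simp [PiLp.inner_apply, Complex.inner]

/-- The i₀-th basis vector is the normalized gradient representing ℓ, so ℓ sees only one complex
coordinate. The other n-1 complex directions are annihilated by ℓ. -/
theorem exists_adapted_basis {n : ℕ} (i₀ : Fin n) (ℓ : CSpace n →L[ℝ] ℝ) :
    ∃ b : OrthonormalBasis (Fin n) ℂ (CSpace n), ∀ v, |ℓ v| ≤ ‖ℓ‖ * ‖b.repr v i₀‖ := by
  set g := (InnerProductSpace.toDual ℝ (CSpace n)).symm ℓ with hg
  have hℓ : ∀ v, ℓ v = (inner ℂ g v).re := fun v => by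
    rw [← re_inner_eq, hg, InnerProductSpace.toDual_symm_apply]
  have hgn : ‖g‖ = ‖ℓ‖ := by rw [hg, LinearIsometryEquiv.norm_map]
  obtain ⟨ν, hν, hgν⟩ : ∃ ν : CSpace n, ‖ν‖ = 1 ∧ g = (‖g‖ : ℂ) • ν := by
    by_cases h0 : g = 0
    · exact ⟨EuclideanSpace.single i₀ 1, by simp, by simp [h0]⟩
    · refine ⟨(‖g‖ : ℂ)⁻¹ • g, ?_, ?_⟩
      · rw [norm_smul, norm_inv, Complex.norm_real, norm_norm, inv_mul_cancel₀ (norm_ne_zero_iff.2 h0)]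
      · rw [smul_smul, mul_inv_cancel₀ (by simpa using h0), one_smul]
  have ho : Orthonormal ℂ (({i₀} : Set (Fin n)).domRestrict fun _ => ν) := by
    refine ⟨fun i => hν, fun i j hij => absurd (Subsingleton.elim i j) hij⟩
  obtain ⟨b, hb⟩ := ho.exists_orthonormalBasis_extension_of_card_eq (by simp)
  refine ⟨b, fun v => ?_⟩
  rw [hℓ, hgν, inner_smul_left, b.repr_apply_apply, hb i₀ rfl]
  refine (Complex.abs_re_le_norm _).trans ?_
  rw [norm_mul, hgn]
  simp

theorem abs_taylor_le {E : Type*} [NormedAddCommGroup E] [NormedSpace ℝ E] {χ : E → ℝ}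
    (hχ : ContDiff ℝ 2 χ) {M : ℝ} (hM : ∀ z, ‖fderiv ℝ (fderiv ℝ χ) z‖ ≤ M) (z v : E) :
    |χ (z + v) - χ z - fderiv ℝ χ z v| ≤ M * ‖v‖ ^ 2 := by
  have h1 : ContDiff ℝ 1 (fderiv ℝ χ) := hχ.fderiv_right (by norm_num)
  have hd : Differentiable ℝ χ := hχ.differentiable (by norm_num)
  have hM0 : 0 ≤ M := (norm_nonneg (fderiv ℝ (fderiv ℝ χ) z)).trans (hM z)
  have hlip : ∀ y ∈ segment ℝ z (z + v), ‖fderiv ℝ χ y - fderiv ℝ χ z‖ ≤ M * ‖v‖ := fun y hy => by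
    have := convex_univ.norm_image_sub_le_of_norm_fderiv_le (𝕜 := ℝ) (f := fderiv ℝ χ)
      (fun x _ => (h1.differentiable (by norm_num)) x) (fun x _ => hM x)
      (Set.mem_univ z) (Set.mem_univ y)
    refine this.trans ?_
    gcongr
    have := norm_sub_le_of_mem_segment hy
    simpa [norm_sub_rev] using this
  have := (convex_segment z (z + v)).norm_image_sub_le_of_norm_hasFDerivWithin_le' (𝕜 := ℝ)
    (f := χ) (f' := fderiv ℝ χ) (φ := fderiv ℝ χ z)
    (fun x _ => (hd x).hasFDerivAt.hasFDerivWithinAt) hlip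
    (left_mem_segment ℝ z (z + v)) (right_mem_segment ℝ z (z + v))
  rw [Real.norm_eq_abs] at this
  convert! this using 1
  · simp
  · simp; ring

/-- A polydisc of radius aτ along the complex normal and a√τ in the other directions changes τ by
less than τ(z): the linear term sees only the normal coordinate and the quadratic remainder is of
order aτ. It is balanced, so the sub-mean value property applies. -/
theorem exists_pointwise_bound {n : ℕ} (hn : 1 ≤ n) {Ω : Set (CSpace n)} (hΩ : IsBoundedDomain Ω)
    {τ : CSpace n → ℝ} (hτ : IsDefiningFunction Ω τ) : ∃ C : ℝ, 0 < C ∧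
      ∀ w, DiscSubmean Ω w → ∀ z ∈ Ω,
        ENNReal.ofReal (τ z ^ (n + 1)) * ENNReal.ofReal (w z) ≤
          ENNReal.ofReal C * shellMass τ w (2 * τ z) := by
  obtain ⟨c, hc, hvol⟩ := exists_volume_polydisc n
  obtain ⟨M₁, hM₁⟩ := exists_bound_fderiv (hτ.contDiff.of_le (by norm_num)) hτ.hasCompactSupport
  obtain ⟨M₂, hM₂⟩ := exists_bound_fderiv_fderiv hτ.contDiff hτ.hasCompactSupport
  obtain ⟨T, hT⟩ := hτ.contDiff.continuous.bounded_above_of_compact_support hτ.hasCompactSupport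
  have hM₁0 : 0 ≤ M₁ := (norm_nonneg _).trans (hM₁ 0)
  have hM₂0 : 0 ≤ M₂ := (norm_nonneg (fderiv ℝ (fderiv ℝ τ) 0)).trans (hM₂ 0)
  have hT0 : 0 ≤ T := (norm_nonneg _).trans (hT 0)
  -- With a = 1/S the linear and quadratic variations of τ add up to less than τ(z). The summand 2
  -- keeps S positive and a ≤ 1, whence a² ≤ a.
  set S := M₁ + M₂ * (n * (T + 1)) + 2 with hS
  have hSpos : 0 < S := by positivity
  set a := 1 / S with ha
  have ha0 : 0 < a := by positivity
  have ha1 : a ≤ 1 := by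
    rw [ha, div_le_one hSpos]
    have : 0 ≤ M₂ * (n * (T + 1)) := by positivity
    linarith
  have haS : a * (M₁ + M₂ * (n * (T + 1))) < 1 := by
    rw [ha, one_div_mul_eq_div, div_lt_one hSpos]; linarith
  set c' : ℝ := c * (Real.pi * a ^ 2) ^ n with hc'
  have hc'0 : 0 < c' := by have := Real.pi_pos; positivity
  refine ⟨1 / c', by positivity, fun w hw z hz => ?_⟩
  set t := τ z with ht
  have ht0 : 0 < t := (hτ.mem_iff z).1 hz
  have htT : t ≤ T := (le_abs_self _).trans (hT z)
  let i₀ : Fin n := ⟨0, hn⟩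
  obtain ⟨b, hb⟩ := exists_adapted_basis i₀ (fderiv ℝ τ z)
  let r : Fin n → ℝ := fun j => a * Real.sqrt t * if j = i₀ then Real.sqrt t else 1
  let D : Set (CSpace n) := {v | ∀ j, ‖b.repr v j‖ < r j}
  have hst : Real.sqrt t * Real.sqrt t = t := Real.mul_self_sqrt ht0.le
  have hr2 : ∀ j, r j ^ 2 = a ^ 2 * t * if j = i₀ then t else 1 := fun j => by
    by_cases h : j = i₀
    · simp only [r, h, if_true]; linear_combination (a ^ 2 * (Real.sqrt t * Real.sqrt t + t)) * hst
    · simp only [r, h, if_false]; linear_combination (a ^ 2) * hst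
  have hDopen : IsOpen D := by
    have : D = ⋂ j, {v | ‖b.repr v j‖ < r j} := by ext v; simp [D]
    rw [this]
    refine isOpen_iInter_of_finite fun j => isOpen_lt ?_ continuous_const
    have : Continuous b.repr := b.repr.continuous
    fun_prop
  have hDvol : volume D = ENNReal.ofReal (c' * t ^ (n + 1)) := by
    let e : CSpace n ≃ₗᵢ[ℝ] CSpace n := ⟨b.repr.toLinearEquiv.restrictScalars ℝ, b.repr.norm_map⟩
    have h1 : D = e ⁻¹' {v | ∀ j, ‖v j‖ < r j} := rfl
    have hm : MeasurableSet {v : CSpace n | ∀ j, ‖v j‖ < r j} := by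
      have : {v : CSpace n | ∀ j, ‖v j‖ < r j} = ⋂ j, {v | ‖v j‖ < r j} := by ext v; simp
      rw [this]
      refine (isOpen_iInter_of_finite fun j => isOpen_lt ?_ continuous_const).measurableSet
      fun_prop
    rw [h1, e.measurePreserving.measure_preimage hm.nullMeasurableSet, hvol]
    have h2 : ∀ j, ENNReal.ofReal (r j) ^ 2 * (NNReal.pi : ℝ≥0∞) =
        ENNReal.ofReal (Real.pi * (a ^ 2 * t * if j = i₀ then t else 1)) := fun j => by
      have hr0 : 0 ≤ r j := by
        simp only [r]; split_ifs <;> positivity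
      have hpi : (NNReal.pi : ℝ≥0∞) = ENNReal.ofReal Real.pi := by
        rw [← NNReal.coe_real_pi, ENNReal.ofReal_coe_nnreal]
      rw [← ENNReal.ofReal_pow hr0, hr2, hpi, mul_comm Real.pi,
        ← ENNReal.ofReal_mul (by split_ifs <;> positivity)]
    simp only [h2]
    rw [← ENNReal.ofReal_prod_of_nonneg fun j _ => by have := Real.pi_pos; split_ifs <;> positivity]
    rw [← ENNReal.ofReal_coe_nnreal, ← ENNReal.ofReal_mul c.coe_nonneg]
    congr 1
    simp only [Finset.prod_mul_distrib, Finset.prod_const, Finset.card_univ, Fintype.card_fin,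
      Finset.prod_ite_eq', Finset.mem_univ, if_true, hc']
    ring
  have hshell : ∀ v ∈ D, 0 < τ (z + v) ∧ τ (z + v) < 2 * t := by
    intro v hv
    have h1 := abs_taylor_le hτ.contDiff hM₂ z v
    have h2 : |fderiv ℝ τ z v| ≤ M₁ * (a * t) := by
      have h3 : ‖b.repr v i₀‖ ≤ a * t := by
        have := (hv i₀).le
        simp only [r, if_true] at this
        rwa [mul_assoc, hst] at this
      calc _ ≤ ‖fderiv ℝ τ z‖ * ‖b.repr v i₀‖ := hb v
        _ ≤ M₁ * (a * t) := by gcongr; exact hM₁ z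
    have h3 : ‖v‖ ^ 2 ≤ n * (T + 1) * (a * t) := by
      rw [← b.repr.norm_map v, EuclideanSpace.norm_sq_eq]
      calc ∑ j, ‖b.repr v j‖ ^ 2 ≤ ∑ j : Fin n, (T + 1) * (a * t) := by
            refine Finset.sum_le_sum fun j _ => ?_
            have h4 : ‖b.repr v j‖ ^ 2 ≤ r j ^ 2 :=
              pow_le_pow_left₀ (norm_nonneg _) (hv j).le 2
            refine h4.trans ?_
            rw [hr2]
            have h5 : (if j = i₀ then t else 1) ≤ T + 1 := by split_ifs <;> linarith
            have h6 : a ^ 2 * t ≤ a * t := by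
              have : a ^ 2 ≤ a := by nlinarith
              gcongr
            calc _ ≤ a * t * (T + 1) := by
                  apply mul_le_mul h6 h5 _ (by positivity)
                  split_ifs <;> positivity
              _ = _ := by ring
        _ = _ := by simp; ring
    have h4 : M₂ * ‖v‖ ^ 2 ≤ M₂ * (n * (T + 1) * (a * t)) := by gcongr
    have h5 : M₁ * (a * t) + M₂ * (n * (T + 1) * (a * t)) < t := by
      have := mul_lt_mul_of_pos_right haS ht0
      nlinarith
    have := abs_le.1 h1
    have := abs_le.1 h2
    constructor <;> linarith
  have key := hw.mul_volume_le hΩ.isOpen hDopen.measurableSet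
    (z := z) (fun ζ hζ ξ hξ j => by
      rw [map_smul]
      have : ‖(ζ • b.repr ξ) j‖ = ‖ζ‖ * ‖b.repr ξ j‖ := by simp
      rw [this]
      refine lt_of_le_of_lt ?_ (hξ j)
      exact mul_le_of_le_one_left (norm_nonneg _) hζ)
    (fun ξ hξ => (hτ.mem_iff _).2 (hshell ξ hξ).1)
  have hsm : MeasurableSet {z | 0 < τ z ∧ τ z < 2 * t} :=
    ((isOpen_lt continuous_const hτ.contDiff.continuous).inter
      (isOpen_lt hτ.contDiff.continuous continuous_const)).measurableSet
  have hle : ∫⁻ ξ in D, ENNReal.ofReal (w (z + ξ)) ≤ shellMass τ w (2 * t) := by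
    rw [shellMass, ← lintegral_indicator hDopen.measurableSet, ← lintegral_indicator hsm]
    refine le_trans (lintegral_mono fun ξ => ?_) (lintegral_add_left_eq_self
      ({z | 0 < τ z ∧ τ z < 2 * t}.indicator fun z => ENNReal.ofReal (w z)) z).le
    by_cases hξ : ξ ∈ D
    · have : z + ξ ∈ {z | 0 < τ z ∧ τ z < 2 * t} := hshell ξ hξ
      simp only [Set.indicator_of_mem hξ, Set.indicator_of_mem this, le_refl]
    · simp [hξ]
  have hfin := key.trans hle
  rw [hDvol] at hfin
  have e : ENNReal.ofReal (t ^ (n + 1)) =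
      ENNReal.ofReal (1 / c') * ENNReal.ofReal (c' * t ^ (n + 1)) := by
    rw [← ENNReal.ofReal_mul (by positivity)]
    congr 1
    field_simp
  rw [e, mul_assoc, mul_comm (ENNReal.ofReal (c' * t ^ (n + 1)))]
  gcongr

/-! ### A coarea-type inequality for Lipschitz functions -/

theorem exists_adapted_equiv {n : ℕ} (hn : 1 ≤ n) {e : CSpace n} (he : e ≠ 0) :
    ∃ Ψ : CSpace n ≃L[ℝ] (EuclideanSpace ℝ (Fin (2 * n - 1)) × ℝ), Ψ e = (0, 1) := by
  have h1 : Module.finrank ℝ (CSpace n) = 2 * n := by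
    rw [finrank_real_of_complex, finrank_euclideanSpace_fin]
  have h2 : Module.finrank ℝ (EuclideanSpace ℝ (Fin (2 * n - 1)) × ℝ) = 2 * n := by
    rw [Module.finrank_prod, finrank_euclideanSpace_fin, Module.finrank_self]
    omega
  let Ψ₀ := ContinuousLinearEquiv.ofFinrankEq (h1.trans h2.symm)
  have h3 : Ψ₀ e ≠ 0 := by simpa using he
  obtain ⟨A, hA⟩ := SeparatingDual.exists_continuousLinearEquiv_apply_eq (R := ℝ) h3
    (y := ((0, 1) : EuclideanSpace ℝ (Fin (2 * n - 1)) × ℝ)) (by simp)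
  exact ⟨Ψ₀.trans A, hA⟩

/-- Both Haar measures are multiples of the Hausdorff measure of the common dimension, which an
antilipschitz map shrinks by at most K^dim. No measurability of S is needed. -/
theorem exists_addHaar_image_le {E F : Type*} [NormedAddCommGroup E] [NormedSpace ℝ E]
    [FiniteDimensional ℝ E] [MeasurableSpace E] [BorelSpace E] [NormedAddCommGroup F]
    [NormedSpace ℝ F] [FiniteDimensional ℝ F] [MeasurableSpace F] [BorelSpace F]
    (μ : Measure E) [μ.IsAddHaarMeasure] (ν : Measure F) [ν.IsAddHaarMeasure]
    (hfr : Module.finrank ℝ E = Module.finrank ℝ F) (K : ℝ≥0) :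
    ∃ C : ℝ≥0, ∀ (φ : E → F) (S : Set E), AntilipschitzWith K (S.domRestrict φ) →
      μ S ≤ C * ν (φ '' S) := by
  have h1 := Measure.isAddLeftInvariant_eq_smul μ μH[Module.finrank ℝ E]
  have h2 := Measure.isAddLeftInvariant_eq_smul (μH[Module.finrank ℝ F] : Measure F) ν
  set a := μ.addHaarScalarFactor μH[Module.finrank ℝ E]
  set a' := (μH[Module.finrank ℝ F] : Measure F).addHaarScalarFactor ν
  refine ⟨a * K ^ (Module.finrank ℝ E) * a', fun φ S hφ => ?_⟩
  rw [h1, Measure.smul_apply]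
  have h3 := hφ.le_hausdorffMeasure_image (d := Module.finrank ℝ E) (by positivity) Set.univ
  rw [Set.image_univ, Set.range_domRestrict] at h3
  have h4 : (μH[Module.finrank ℝ E] : Measure E) S = μH[Module.finrank ℝ E] (Set.univ : Set S) := by
    rw [← (isometry_subtype_coe (s := S)).hausdorffMeasure_image (Or.inl (by positivity))]
    simp
  rw [h4]
  calc a • μH[Module.finrank ℝ E] (Set.univ : Set S)
      ≤ a • ((K : ℝ≥0∞) ^ (Module.finrank ℝ E : ℝ) * μH[Module.finrank ℝ E] (φ '' S)) := by gcongr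
    _ = _ := by
      rw [hfr, h2, Measure.smul_apply, ENNReal.rpow_natCast]
      simp only [ENNReal.smul_def, smul_eq_mul, ENNReal.coe_mul, ENNReal.coe_pow]
      ring

/-- A continuous injection of a Borel subset of a Polish space is a measurable embedding. Hence g ∘
φ⁻¹, extended by zero, is measurable, and the comparison of sets becomes one of integrals. -/
theorem lintegral_le_of_comparison {X Y : Type*} [MeasurableSpace X] [TopologicalSpace X]
    [PolishSpace X] [BorelSpace X] [MeasurableSpace Y] [TopologicalSpace Y] [T2Space Y]
    [BorelSpace Y] {μ : Measure X} {ν : Measure Y} {C : ℝ≥0} {U : Set X} (hU : MeasurableSet U)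
    {φ : X → Y} (hφ : ContinuousOn φ U) (hinj : U.InjOn φ)
    (hle : ∀ S ⊆ U, μ S ≤ C * ν (φ '' S)) {g : X → ℝ≥0∞} (hg : Measurable g) :
    ∃ G : Y → ℝ≥0∞, Measurable G ∧ (∀ x ∈ U, G (φ x) = g x) ∧ (∀ y ∉ φ '' U, G y = 0) ∧
      ∫⁻ x in U, g x ∂μ ≤ C * ∫⁻ y, G y ∂ν := by
  have hi : MeasurableEmbedding (U.domRestrict φ) := hφ.measurableEmbedding hU hinj
  set i := U.domRestrict φ with hi_def
  have hgm : Measurable fun x : U => g x := hg.comp measurable_subtype_coe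
  refine ⟨Function.extend i (fun x => g x) 0, hi.measurable_extend hgm measurable_const,
    fun x hx => ?_, fun y hy => ?_, ?_⟩
  · exact hi.injective.extend_apply (fun x : U => g x) 0 ⟨x, hx⟩
  · exact Function.extend_apply' _ _ _ fun ⟨x, hx⟩ => hy ⟨x, x.2, hx⟩
  · have hm : Measure.comap ((↑) : U → X) μ ≤ C • Measure.comap i ν := by
      refine Measure.le_iff.2 fun S hS => ?_
      rw [Measure.smul_apply, (MeasurableEmbedding.subtype_coe hU).comap_apply, hi.comap_apply]
      refine (hle _ (by rintro _ ⟨x, _, rfl⟩; exact x.2)).trans_eq ?_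
      rw [Set.image_image]
      rfl
    rw [← lintegral_subtype_comap hU]
    calc ∫⁻ x : U, g x ∂(Measure.comap (↑) μ) ≤ ∫⁻ x : U, g x ∂(C • Measure.comap i ν) :=
          lintegral_mono' hm le_rfl
      _ = C * ∫⁻ x : U, g x ∂(Measure.comap i ν) := by
          rw [lintegral_smul_measure]; rfl
      _ = C * ∫⁻ x, Function.extend i (fun x : U => g x) 0 (i x) ∂(Measure.comap i ν) := by
          simp only [hi.injective.extend_apply]
      _ = C * ∫⁻ y, Function.extend i (fun x : U => g x) 0 y ∂(Measure.map i (Measure.comap i ν)) := by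
          rw [hi.lintegral_map]
      _ ≤ C * ∫⁻ y, Function.extend i (fun x : U => g x) 0 y ∂ν := by
          gcongr
          rw [hi.map_comap]
          exact Measure.restrict_le_self

theorem lintegral_le_of_lipschitz_projection {X : Type*} [PseudoEMetricSpace X] [MeasurableSpace X]
    {Y : Type*} [MeasurableSpace Y] {μ : Measure X} {ν : Measure Y} {C : ℝ≥0} {P : X → Y}
    (hP : Measurable P) (hle : ∀ S, ν (P '' S) ≤ C * μ S) {W : Set X} {T : Set Y}
    (hT : MeasurableSet T) (hTW : T ⊆ P '' W) {H : Y → ℝ≥0∞} (hH : Measurable H)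
    (hHT : ∀ y ∉ T, H y = 0) : ∫⁻ y, H y ∂ν ≤ C * ∫⁻ x in W, H (P x) ∂μ := by
  have e : ∫⁻ y, H y ∂ν = ∫⁻ y in T, H y ∂ν := by
    rw [← lintegral_indicator hT]
    congr 1
    ext y
    by_cases hy : y ∈ T <;> simp [hy, hHT]
  have hm : ν.restrict T ≤ C • Measure.map P (μ.restrict W) := by
    refine Measure.le_iff.2 fun B hB => ?_
    rw [Measure.smul_apply, Measure.map_apply hP hB, Measure.restrict_apply hB,
      Measure.restrict_apply (hP hB)]
    refine (measure_mono ?_).trans (hle _)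
    rintro y ⟨hyB, hyT⟩
    obtain ⟨x, hx, rfl⟩ := hTW hyT
    exact ⟨x, ⟨hyB, hx⟩, rfl⟩
  rw [e]
  refine (lintegral_mono' hm le_rfl).trans_eq ?_
  rw [lintegral_smul_measure, lintegral_map hH hP]
  rfl

theorem exists_projection_le {X : Type*} [EMetricSpace X] [MeasurableSpace X] [BorelSpace X] (d : ℕ)
    {P : X → EuclideanSpace ℝ (Fin d)} {K : ℝ≥0} (hP : LipschitzWith K P) :
    ∃ C : ℝ≥0, ∀ S, volume (P '' S) ≤ C * (μHE[d] : Measure X) S := by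
  refine ⟨K ^ d, fun S => ?_⟩
  rw [← EuclideanSpace.euclideanHausdorffMeasure_eq_volume]
  unfold Measure.euclideanHausdorffMeasure
  have := hP.hausdorffMeasure_image_le (d := d) (by positivity) S
  rw [ENNReal.rpow_natCast] at this
  rw [Measure.smul_apply, Measure.smul_apply]
  simp only [ENNReal.smul_def, smul_eq_mul, ENNReal.coe_pow]
  rw [mul_left_comm]
  gcongr

/-- A coarea-type inequality for a Lipschitz function that grows at a definite rate along `e`. -/
theorem exists_lintegral_le_slices {n : ℕ} {e : CSpace n}
    {Ψ : CSpace n ≃L[ℝ] (EuclideanSpace ℝ (Fin (2 * n - 1)) × ℝ)} (hΨ : Ψ e = (0, 1))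
    {c : ℝ} (hc : 0 < c) {δ : CSpace n → ℝ} (hδ : LipschitzWith 1 δ) {V : Set (CSpace n)}
    (hV : MeasurableSet V) (hgrow : ∀ z ∈ V, ∀ z' ∈ V, 0 ≤ (Ψ (z' - z)).2 →
      δ z + c * (Ψ (z' - z)).2 ≤ δ (z + (Ψ (z' - z)).2 • e)) :
    ∃ C : ℝ≥0, ∀ (g : CSpace n → ℝ≥0∞) (A : ℝ≥0∞) (b : ℝ), Measurable g →
      (∀ ε > 0, ∫⁻ z in {z | z ∈ V ∧ δ z = ε}, g z ∂μHE[2 * n - 1] ≤ A) →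
      ∫⁻ z in {z | z ∈ V ∧ 0 < δ z ∧ δ z < b}, g z ≤ C * ENNReal.ofReal b * A := by
  set F := EuclideanSpace ℝ (Fin (2 * n - 1))
  let P : CSpace n → F := fun z => (Ψ z).1
  -- Φ replaces the coordinate along e by δ. It is antilipschitz on V, so volume is controlled by
  -- Fubini in (P, δ), and each slice at height t is the projection of a piece of {δ = t}.
  let Φ : CSpace n → F × ℝ := fun z => (P z, δ z)
  set N := ‖(Ψ.symm : F × ℝ →L[ℝ] CSpace n)‖ with hN
  have hN0 : 0 ≤ N := norm_nonneg _
  -- Go from z to z' by s along e, then by Ψ⁻¹(p, 0). The first move raises δ by at least cs and the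
  -- second changes it by at most N‖p‖, so s is bounded by the distance of the images.
  have hrate : ∀ z ∈ V, ∀ z' ∈ V, 0 ≤ (Ψ (z' - z)).2 →
      c * (Ψ (z' - z)).2 ≤ (1 + N) * dist (Φ z) (Φ z') := by
    intro z hz z' hz' hs
    set s := (Ψ (z' - z)).2
    set p := (Ψ (z' - z)).1 with hp
    have h1 := hgrow z hz z' hz' hs
    have h2 : z' = z + s • e + Ψ.symm (p, 0) := by
      apply Ψ.injective
      rw [map_add, map_add, map_smul, hΨ, ContinuousLinearEquiv.apply_symm_apply]
      have : Ψ (z' - z) = (p, s) := rfl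
      rw [map_sub] at this
      rw [sub_eq_iff_eq_add.1 this]
      ext <;> simp [add_comm]
    have h3 : δ (z + s • e) - δ z' ≤ N * ‖p‖ := by
      have h4 := hδ.dist_le_mul (z + s • e) z'
      rw [Real.dist_eq, NNReal.coe_one, one_mul, dist_comm, h2, dist_self_add_left] at h4
      have h5 := (Ψ.symm : F × ℝ →L[ℝ] CSpace n).le_opNorm (p, 0)
      rw [h2]
      refine (le_abs_self _).trans (h4.trans (h5.trans_eq ?_))
      simp [hN]
    have h6 : ‖p‖ ≤ dist (Φ z) (Φ z') := by
      have : p = P z' - P z := by simp [hp, P]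
      rw [this, ← dist_eq_norm, dist_comm]
      exact le_max_left _ _
    have h7 : δ z' - δ z ≤ dist (Φ z) (Φ z') := by
      refine (le_abs_self _).trans ?_
      rw [← Real.dist_eq, dist_comm]
      exact le_max_right _ _
    have h8 : N * ‖p‖ ≤ N * dist (Φ z) (Φ z') := by gcongr
    linarith
  have hanti : ∃ K : ℝ≥0, ∀ S ⊆ V, AntilipschitzWith K (S.domRestrict Φ) := by
    refine ⟨⟨N * max 1 ((1 + N) / c), by positivity⟩, fun S hS => ?_⟩
    refine AntilipschitzWith.of_le_mul_dist ?_
    rintro ⟨z, hz⟩ ⟨z', hz'⟩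
    have hz := hS hz
    have hz' := hS hz'
    change dist z z' ≤ N * max 1 ((1 + N) / c) * dist (Φ z) (Φ z')
    have hs : |(Ψ (z' - z)).2| ≤ (1 + N) / c * dist (Φ z) (Φ z') := by
      rw [div_mul_eq_mul_div, le_div_iff₀ hc, mul_comm]
      rcases le_total 0 (Ψ (z' - z)).2 with h | h
      · rw [abs_of_nonneg h]; exact hrate z hz z' hz' h
      · have e1 : (Ψ (z - z')).2 = -(Ψ (z' - z)).2 := by
          rw [← neg_sub z' z, map_neg]; rfl
        have := hrate z' hz' z hz (by rw [e1]; linarith)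
        rw [abs_of_nonpos h, ← e1, dist_comm]
        exact this
    have hp : ‖(Ψ (z' - z)).1‖ ≤ 1 * dist (Φ z) (Φ z') := by
      have : (Ψ (z' - z)).1 = P z' - P z := by simp [P]
      rw [this, ← dist_eq_norm, dist_comm, one_mul]
      exact le_max_left _ _
    have h1 : dist z z' ≤ N * ‖Ψ (z' - z)‖ := by
      have := (Ψ.symm : F × ℝ →L[ℝ] CSpace n).le_opNorm (Ψ (z' - z))
      rw [dist_comm, dist_eq_norm]
      simpa using this
    refine h1.trans ?_
    rw [mul_assoc]
    gcongr
    rw [Prod.norm_def]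
    refine max_le (hp.trans ?_) ((Real.norm_eq_abs _).trans_le (hs.trans ?_))
    · gcongr; exact le_max_left _ _
    · gcongr; exact le_max_right _ _
  obtain ⟨K, hK⟩ := hanti
  have : (volume : Measure (F × ℝ)).IsAddHaarMeasure := by
    rw [Measure.volume_eq_prod]
    infer_instance
  obtain ⟨C₁, hC₁⟩ := exists_addHaar_image_le (volume : Measure (CSpace n))
    (volume : Measure (F × ℝ)) Ψ.toLinearEquiv.finrank_eq K
  have hPlip : LipschitzWith ‖(Ψ : CSpace n →L[ℝ] F × ℝ)‖₊ P := by
    have := LipschitzWith.prod_fst.comp (Ψ : CSpace n →L[ℝ] F × ℝ).lipschitz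
    rw [one_mul] at this
    exact this
  obtain ⟨C₂, hC₂⟩ := exists_projection_le (2 * n - 1) hPlip
  refine ⟨C₁ * C₂, fun g A b hg hA => ?_⟩
  set U : Set (CSpace n) := {z | z ∈ V ∧ 0 < δ z ∧ δ z < b} with hU
  have hUm : MeasurableSet U := hV.inter
    ((isOpen_lt continuous_const hδ.continuous).inter
      (isOpen_lt hδ.continuous continuous_const)).measurableSet
  have hUV : U ⊆ V := fun z hz => hz.1
  have hΦc : Continuous Φ := hPlip.continuous.prodMk hδ.continuous
  have hinj : U.InjOn Φ := Set.injOn_iff_injective.2 (hK U hUV).injective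
  obtain ⟨G, hGm, hGU, hG0, hGle⟩ := lintegral_le_of_comparison (μ := volume) (ν := volume) hUm
    hΦc.continuousOn hinj (fun S hS => hC₁ Φ S (hK S (hS.trans hUV))) hg
  have hrange : MeasurableSet (Φ '' U) := hUm.image_of_continuousOn_injOn hΦc.continuousOn hinj
  have hslice : ∀ t : ℝ, ∫⁻ x, G (x, t) ≤ (Set.Ioo 0 b).indicator (fun _ => C₂ * A) t := by
    intro t
    by_cases ht : t ∈ Set.Ioo 0 b
    · rw [Set.indicator_of_mem ht]
      have h1 := lintegral_le_of_lipschitz_projection (μ := (μHE[2 * n - 1] : Measure (CSpace n)))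
        (ν := volume) hPlip.continuous.measurable hC₂
        (W := {z | z ∈ V ∧ δ z = t}) (T := {x | (x, t) ∈ Φ '' U})
        (hrange.preimage (by fun_prop : Measurable fun x : F => (x, t)))
        (by
          rintro x ⟨z, hz, hzx⟩
          have h2 : P z = x := congrArg Prod.fst hzx
          have h3 : δ z = t := congrArg Prod.snd hzx
          exact ⟨z, ⟨hz.1, h3⟩, h2⟩)
        (H := fun x => G (x, t)) (hGm.comp (by fun_prop)) (fun x hx => hG0 _ hx)
      refine h1.trans ?_
      gcongr
      refine le_trans (le_of_eq ?_) (hA t ht.1)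
      have hWm : MeasurableSet {z | z ∈ V ∧ δ z = t} :=
        hV.inter (isClosed_eq hδ.continuous continuous_const).measurableSet
      refine setLIntegral_congr_fun hWm fun z hz => ?_
      have hzU : z ∈ U := ⟨hz.1, by rw [hz.2]; exact ht.1, by rw [hz.2]; exact ht.2⟩
      have := hGU z hzU
      simp only [Φ, hz.2] at this
      exact this
    · rw [Set.indicator_of_notMem ht]
      have : ∀ x, G (x, t) = 0 := fun x => hG0 _ (by
        rintro ⟨z, hz, hzx⟩
        have h3 : δ z = t := congrArg Prod.snd hzx
        exact ht ⟨h3 ▸ hz.2.1, h3 ▸ hz.2.2⟩)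
      simp [this]
  calc ∫⁻ z in U, g z ≤ C₁ * ∫⁻ y, G y := hGle
    _ = C₁ * ∫⁻ t, ∫⁻ x, G (x, t) := by
        rw [Measure.volume_eq_prod, lintegral_prod_symm _ hGm.aemeasurable]
    _ ≤ C₁ * ∫⁻ t, (Set.Ioo 0 b).indicator (fun _ => C₂ * A) t := by
        gcongr with t; exact hslice t
    _ = _ := by
        rw [lintegral_indicator measurableSet_Ioo, lintegral_const, Measure.restrict_apply_univ,
          Real.volume_Ioo, sub_zero, ENNReal.coe_mul]
        ring

/-! ### Boundary distance and integration over its level sets -/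

theorem ball_boundaryDist_subset {n : ℕ} {Ω : Set (CSpace n)} (hΩ : IsOpen Ω) {z : CSpace n}
    (hz : z ∈ Ω) : Metric.ball z (boundaryDist Ω z) ⊆ Ω := by
  rcases le_or_gt (boundaryDist Ω z) 0 with h0 | h0
  · rw [Metric.ball_eq_empty.2 h0]; exact Set.empty_subset _
  refine (convex_ball z _).isPreconnected.subset_left_of_subset_union hΩ
    (isClosed_closure (s := Ω)).isOpen_compl
    (Set.disjoint_left.2 fun x hx hx' => hx' (subset_closure hx)) (fun y hy => ?_)
    ⟨z, Metric.mem_ball_self h0, hz⟩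
  by_contra h
  rw [Set.mem_union, not_or, Set.notMem_compl_iff] at h
  have hyf : y ∈ frontier Ω := by rw [hΩ.frontier_eq]; exact ⟨h.2, h.1⟩
  have h1 : boundaryDist Ω z ≤ dist z y := Metric.infDist_le_dist_of_mem hyf
  rw [Metric.mem_ball, dist_comm] at hy
  linarith

theorem setLIntegral_biUnion_finset_le {X ι : Type*} [MeasurableSpace X] (μ : Measure X)
    (I : Finset ι) (S : ι → Set X) (g : X → ℝ≥0∞) :
    ∫⁻ x in ⋃ i ∈ I, S i, g x ∂μ ≤ ∑ i ∈ I, ∫⁻ x in S i, g x ∂μ := by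
  classical
  induction I using Finset.induction_on with
  | empty => simp
  | insert a I ha ih =>
    rw [Finset.set_biUnion_insert, Finset.sum_insert ha]
    exact (lintegral_union_le _ _ _).trans (by gcongr)

theorem gradSq_le {n : ℕ} (τ : CSpace n → ℝ) (z : CSpace n) :
    gradSq τ z ≤ 2 * n * ‖fderiv ℝ τ z‖ ^ 2 := by
  have h : ∀ v : CSpace n, ‖v‖ = 1 → fderiv ℝ τ z v ^ 2 ≤ ‖fderiv ℝ τ z‖ ^ 2 := fun v hv => by
    have := (fderiv ℝ τ z).le_opNorm v
    rw [hv, mul_one, Real.norm_eq_abs] at this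
    rw [← sq_abs]
    exact pow_le_pow_left₀ (abs_nonneg _) this 2
  have h1 : ∀ j : Fin n, ‖(EuclideanSpace.single j 1 : CSpace n)‖ = 1 := fun j => by simp
  have h2 : ∀ j : Fin n, ‖Complex.I • (EuclideanSpace.single j 1 : CSpace n)‖ = 1 := fun j => by
    rw [norm_smul, Complex.norm_I, h1, one_mul]
  calc gradSq τ z ≤ ∑ _j : Fin n, (‖fderiv ℝ τ z‖ ^ 2 + ‖fderiv ℝ τ z‖ ^ 2) :=
        Finset.sum_le_sum fun j _ => add_le_add (h _ (h1 j)) (h _ (h2 j))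
    _ = _ := by simp; ring

/-- Walk from z against the gradient. If the ball of radius δ(z) were too large, a step slightly
longer than 4τ(z)/m would stay in Ω, while Taylor's formula already makes τ negative there. -/
theorem IsDefiningFunction.exists_boundaryDist_le {n : ℕ} (hn : 1 ≤ n) {Ω : Set (CSpace n)}
    (hΩ : IsBoundedDomain Ω) {τ : CSpace n → ℝ} (hτ : IsDefiningFunction Ω τ) :
    ∃ t C : ℝ, 0 < t ∧ 0 < C ∧ ∀ z ∈ Ω, τ z < t → boundaryDist Ω z ≤ C * τ z := by
  obtain ⟨c, hc, hgrad⟩ := hτ.exists_gradSq_lower_bound hΩ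
  obtain ⟨M, hM⟩ := exists_bound_fderiv_fderiv hτ.contDiff hτ.hasCompactSupport
  have hM0 : 0 ≤ M := (norm_nonneg (fderiv ℝ (fderiv ℝ τ) 0)).trans (hM 0)
  have hn' : (0 : ℝ) < n := by exact_mod_cast hn
  set m := Real.sqrt (c / (2 * n)) with hm
  have hm0 : 0 < m := Real.sqrt_pos.2 (by positivity)
  -- Steps up to s₁ have quadratic error at most sm/4, half of the guaranteed linear decrease sm/2.
  set s₁ := m / (4 * (M + 1)) with hs₁
  have hs₁0 : 0 < s₁ := by positivity
  refine ⟨min c (m * s₁ / 8), 4 / m, by positivity, by positivity, fun z hz hzt => ?_⟩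
  have hτz := (hτ.mem_iff z).1 hz
  have hd : m ≤ ‖fderiv ℝ τ z‖ := by
    have h1 := (hgrad z (subset_closure hz) (hzt.trans_le (min_le_left _ _))).trans (gradSq_le τ z)
    rw [hm]
    refine Real.sqrt_le_iff.2 ⟨norm_nonneg _, ?_⟩
    rw [div_le_iff₀ (by positivity)]
    linarith
  obtain ⟨x, hx1, hx⟩ : ∃ x : CSpace n, ‖x‖ < 1 ∧ m / 2 < fderiv ℝ τ z x := by
    obtain ⟨x, hx1, hx⟩ := (fderiv ℝ τ z).exists_lt_apply_of_lt_opNorm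
      (show m / 2 < ‖fderiv ℝ τ z‖ by linarith)
    rcases le_total 0 (fderiv ℝ τ z x) with h | h
    · exact ⟨x, hx1, by rwa [Real.norm_of_nonneg h] at hx⟩
    · refine ⟨-x, by rwa [norm_neg], ?_⟩
      rw [Real.norm_of_nonpos h] at hx
      rwa [map_neg]
  by_contra! hcon
  have hlt : 4 / m * τ z < min (boundaryDist Ω z) s₁ := by
    refine lt_min hcon ?_
    have := hzt.trans_le (min_le_right _ _)
    rw [div_mul_eq_mul_div, div_lt_iff₀ hm0]
    nlinarith
  obtain ⟨s, hs, hs'⟩ := exists_between hlt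
  have hs0 : 0 < s := lt_trans (by positivity) hs
  have hmem : z + (-(s • x)) ∈ Ω := by
    apply ball_boundaryDist_subset hΩ.isOpen hz
    rw [Metric.mem_ball, dist_eq_norm, add_sub_cancel_left, norm_neg, norm_smul,
      Real.norm_of_nonneg hs0.le]
    have := hs'.trans_le (min_le_left _ _)
    nlinarith
  have h1 := (hτ.mem_iff _).1 hmem
  have h2 := (abs_le.1 (abs_taylor_le hτ.contDiff hM z (-(s • x)))).2
  rw [map_neg, map_smul, norm_neg, norm_smul, Real.norm_of_nonneg hs0.le, smul_eq_mul] at h2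
  have h3 : (s * ‖x‖) ^ 2 ≤ s ^ 2 := by
    apply pow_le_pow_left₀ (by positivity)
    nlinarith
  have h4 : M * (s * ‖x‖) ^ 2 ≤ M * s ^ 2 := by gcongr
  have h5 : M * s ≤ m / 4 := by
    have : s ≤ m / (4 * (M + 1)) := (hs'.trans_le (min_le_right _ _)).le
    rw [le_div_iff₀ (by positivity)] at this
    nlinarith
  rw [div_mul_eq_mul_div, div_lt_iff₀ hm0] at hs
  nlinarith

theorem lipschitzWith_boundaryDist {n : ℕ} (Ω : Set (CSpace n)) :
    LipschitzWith 1 (boundaryDist Ω) := Metric.lipschitz_infDist_pt _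

/-- Any y within δ(z) + cs of z + se has the form (z + a) + s(e + b) with |a| < δ(z) and |b| ≤ c.
The start z + a lies in Ω, and τ does not decrease along e + b near x when c is small, so y is in Ω.
Differentiability of δ is not needed. -/
theorem IsDefiningFunction.exists_growth_direction {n : ℕ} {Ω : Set (CSpace n)} (hΩ : IsOpen Ω)
    {τ : CSpace n → ℝ} (hτ : IsDefiningFunction Ω τ) {x : CSpace n} (hx : x ∈ frontier Ω) :
    ∃ e : CSpace n, e ≠ 0 ∧ ∃ c R : ℝ, 0 < c ∧ 0 < R ∧ ∀ z ∈ Ω, dist z x < R → ∀ s, 0 ≤ s → s ≤ R →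
      boundaryDist Ω z + c * s ≤ boundaryDist Ω (z + s • e) := by
  obtain ⟨M, hM⟩ := exists_bound_fderiv (hτ.contDiff.of_le (by norm_num)) hτ.hasCompactSupport
  have hM0 : 0 ≤ M := (norm_nonneg _).trans (hM 0)
  have hd : Differentiable ℝ τ := hτ.contDiff.differentiable (by norm_num)
  obtain ⟨e, he1, he⟩ : ∃ e : CSpace n, ‖e‖ < 1 ∧ 0 < fderiv ℝ τ x e := by
    obtain ⟨e, he1, he⟩ := (fderiv ℝ τ x).exists_lt_apply_of_lt_opNorm
      (norm_pos_iff.2 (hτ.fderiv_ne_zero x hx))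
    rcases le_total 0 (fderiv ℝ τ x e) with h | h
    · exact ⟨e, he1, by rwa [Real.norm_of_nonneg h] at he⟩
    · refine ⟨-e, by rwa [norm_neg], ?_⟩
      rw [Real.norm_of_nonpos h] at he
      rwa [map_neg]
  set d := fderiv ℝ τ x e with hd_def
  have hcont : ContinuousAt (fderiv ℝ τ) x :=
    (hτ.contDiff.continuous_fderiv (by norm_num)).continuousAt
  obtain ⟨R', hR', hball⟩ := Metric.continuousAt_iff.1 hcont (d / 8) (by positivity)
  set c := min 1 (d / (4 * (M + 1))) with hc
  have hc0 : 0 < c := by positivity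
  have hMc : M * c ≤ d / 4 := by
    have : c ≤ d / (4 * (M + 1)) := min_le_right _ _
    rw [le_div_iff₀ (by positivity)] at this
    nlinarith
  refine ⟨e, fun h => by simp [hd_def, h] at he, c, R' / 4, hc0, by positivity,
    fun z hz hzx s hs hsR => ?_⟩
  set δ := boundaryDist Ω z with hδ
  have hzf : z ∉ frontier Ω := fun h => by rw [hΩ.frontier_eq] at h; exact h.2 hz
  have hδ0 : 0 < δ := (isClosed_frontier.notMem_iff_infDist_pos ⟨x, hx⟩).1 hzf
  have hδR : δ < R' / 4 := (Metric.infDist_le_dist_of_mem hx).trans_lt hzx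
  refine (Metric.le_infDist ⟨x, hx⟩).2 fun y hy => ?_
  by_contra! hlt
  have hyΩ : y ∉ Ω := by rw [hΩ.frontier_eq] at hy; exact hy.2
  apply hyΩ
  set T := δ + c * s with hT
  have hT0 : 0 < T := by positivity
  set u := y - (z + s • e) with hu
  have hun : ‖u‖ < T := by rwa [hu, ← dist_eq_norm, dist_comm]
  -- The displacement u is split in the proportion δ : cs.
  set a := (δ / T) • u with ha
  set b := (c / T) • u with hb
  have hub : u = a + s • b := by
    rw [ha, hb, smul_smul, ← add_smul]
    have : δ / T + s * (c / T) = 1 := by field_simp; rw [hT]; ring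
    rw [this, one_smul]
  have han : ‖a‖ < δ := by
    rw [ha, norm_smul, Real.norm_of_nonneg (by positivity), div_mul_eq_mul_div, div_lt_iff₀ hT0]
    exact mul_lt_mul_of_pos_left hun hδ0
  have hbn : ‖b‖ ≤ c := by
    rw [hb, norm_smul, Real.norm_of_nonneg (by positivity), div_mul_eq_mul_div, div_le_iff₀ hT0]
    exact mul_le_mul_of_nonneg_left hun.le hc0.le
  have hy_eq : y = z + a + s • (e + b) := by
    have : y = z + s • e + u := by rw [hu]; abel
    rw [this, hub, smul_add]; abel
  have hza : z + a ∈ Ω := ball_boundaryDist_subset hΩ hz (by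
    rw [Metric.mem_ball, dist_eq_norm, add_sub_cancel_left]; exact han)
  have hzaR : z + a ∈ Metric.ball x R' := by
    rw [Metric.mem_ball]
    calc dist (z + a) x ≤ dist (z + a) z + dist z x := dist_triangle _ _ _
      _ < R' := by rw [dist_self_add_left]; linarith
  have hc1 : c ≤ 1 := min_le_left _ _
  have hyR : y ∈ Metric.ball x R' := by
    rw [Metric.mem_ball]
    have h1 : dist y (z + a) ≤ R' / 4 * 2 := by
      rw [hy_eq, dist_self_add_left, norm_smul, Real.norm_of_nonneg hs]
      have : ‖e + b‖ ≤ 2 := (norm_add_le _ _).trans (by linarith)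
      gcongr
    have h2 : dist (z + a) x ≤ dist (z + a) z + dist z x := dist_triangle _ _ _
    rw [dist_self_add_left] at h2
    have := dist_triangle y (z + a) x
    linarith
  obtain ⟨p, hp, hpe⟩ := domain_mvt (f := τ) (f' := fderiv ℝ τ)
    (fun q _ => (hd q).hasFDerivAt.hasFDerivWithinAt) (convex_ball x R') hzaR hyR
  have hpR : p ∈ Metric.ball x R' := (convex_ball x R').segment_subset hzaR hyR hp
  have hpd : ‖fderiv ℝ τ p - fderiv ℝ τ x‖ < d / 8 := by
    rw [← dist_eq_norm]; exact hball hpR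
  have h1 : 0 ≤ fderiv ℝ τ p (e + b) := by
    have e1 : fderiv ℝ τ p (e + b) = d + (fderiv ℝ τ p - fderiv ℝ τ x) e + fderiv ℝ τ p b := by
      rw [map_add, sub_apply]; ring
    have e2 := (abs_le.1 ((fderiv ℝ τ p - fderiv ℝ τ x).le_opNorm e)).1
    have e3 := (abs_le.1 ((fderiv ℝ τ p).le_opNorm b)).1
    have e4 : ‖fderiv ℝ τ p - fderiv ℝ τ x‖ * ‖e‖ ≤ d / 8 * 1 := by gcongr
    have e5 : ‖fderiv ℝ τ p‖ * ‖b‖ ≤ M * c := by gcongr; exact hM p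
    rw [e1]
    linarith
  have h2 : 0 ≤ τ y - τ (z + a) := by
    rw [hpe]
    have : y - (z + a) = s • (e + b) := by rw [hy_eq]; abel
    rw [this, map_smul, smul_eq_mul]
    exact mul_nonneg hs h1
  have h3 := (hτ.mem_iff _).1 hza
  exact (hτ.mem_iff _).2 (by linarith)

theorem IsBoundedDomain.frontier_nonempty {n : ℕ} (hn : 1 ≤ n) {Ω : Set (CSpace n)}
    (hΩ : IsBoundedDomain Ω) : (frontier Ω).Nonempty := by
  rw [nonempty_frontier_iff]
  refine ⟨hΩ.isConnected.nonempty, fun h => ?_⟩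
  have : Nontrivial (CSpace n) :=
    ⟨⟨EuclideanSpace.single ⟨0, hn⟩ 1, 0, fun h0 => by
      have := congrArg (fun v : CSpace n => v ⟨0, hn⟩) h0
      simp at this⟩⟩
  exact NormedSpace.unbounded_univ ℝ (CSpace n) (h ▸ hΩ.isBounded)

theorem IsDefiningFunction.exists_local_slices {n : ℕ} (hn : 1 ≤ n) {Ω : Set (CSpace n)}
    (hΩ : IsOpen Ω) {τ : CSpace n → ℝ} (hτ : IsDefiningFunction Ω τ) {x : CSpace n}
    (hx : x ∈ frontier Ω) : ∃ r > 0, ∃ C : ℝ≥0, ∀ (g : CSpace n → ℝ≥0∞) (A : ℝ≥0∞) (b : ℝ),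
      Measurable g →
      (∀ ε > 0, ∫⁻ z in {z | z ∈ Ω ∧ boundaryDist Ω z = ε}, g z ∂μHE[2 * n - 1] ≤ A) →
      ∫⁻ z in {z | z ∈ Ω ∩ Metric.ball x r ∧ 0 < boundaryDist Ω z ∧ boundaryDist Ω z < b}, g z ≤
        C * ENNReal.ofReal b * A := by
  obtain ⟨e, he, c, R, hc, hR, hgrow⟩ := hτ.exists_growth_direction hΩ hx
  obtain ⟨Ψ, hΨ⟩ := exists_adapted_equiv hn he
  set N := ‖(Ψ : CSpace n →L[ℝ] EuclideanSpace ℝ (Fin (2 * n - 1)) × ℝ)‖ with hN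
  have hN0 : 0 ≤ N := norm_nonneg _
  set r := min R (R / (2 * (N + 1))) with hr
  have hr0 : 0 < r := by positivity
  refine ⟨r, hr0, ?_⟩
  obtain ⟨C, hC⟩ := exists_lintegral_le_slices hΨ hc (lipschitzWith_boundaryDist Ω)
    (V := Ω ∩ Metric.ball x r) (hΩ.inter Metric.isOpen_ball).measurableSet (by
      intro z hz z' hz' hs
      refine hgrow z hz.1 (hz.2.trans_le (min_le_left _ _)) _ hs ?_
      have h1 : ‖z' - z‖ ≤ 2 * r := by
        rw [← dist_eq_norm]
        have h2 : dist z' x < r := hz'.2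
        have h3 : dist z x < r := hz.2
        linarith [dist_triangle_right z' z x]
      have h4 := (Ψ : CSpace n →L[ℝ] EuclideanSpace ℝ (Fin (2 * n - 1)) × ℝ).le_opNorm (z' - z)
      have h5 : (Ψ (z' - z)).2 ≤ ‖Ψ (z' - z)‖ := (Real.le_norm_self _).trans (norm_snd_le _)
      have h6 : r ≤ R / (2 * (N + 1)) := min_le_right _ _
      rw [le_div_iff₀ (by positivity)] at h6
      have h7 : N * ‖z' - z‖ ≤ N * (2 * r) := by gcongr
      have h8 : ‖Ψ (z' - z)‖ ≤ N * ‖z' - z‖ := h4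
      nlinarith)
  refine ⟨C, fun g A b hg hA => hC g A b hg fun ε hε => (lintegral_mono_set ?_).trans (hA ε hε)⟩
  exact fun z hz => ⟨hz.1.1, hz.2⟩

/-- Near the boundary δ ≤ C₀τ, so a thin τ-shell lies in a thin δ-shell; compactness covers the
latter by finitely many balls in which the local estimate holds. -/
theorem IsDefiningFunction.exists_shell_le_slices {n : ℕ} (hn : 1 ≤ n) {Ω : Set (CSpace n)}
    (hΩ : IsBoundedDomain Ω) {τ : CSpace n → ℝ} (hτ : IsDefiningFunction Ω τ) :
    ∃ b₀ : ℝ, 0 < b₀ ∧ ∃ C : ℝ≥0, ∀ (g : CSpace n → ℝ≥0∞) (A : ℝ≥0∞) (b : ℝ), b ≤ b₀ →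
      Measurable g →
      (∀ ε > 0, ∫⁻ z in {z | z ∈ Ω ∧ boundaryDist Ω z = ε}, g z ∂μHE[2 * n - 1] ≤ A) →
      ∫⁻ z in {z | 0 < τ z ∧ τ z < b}, g z ≤ C * ENNReal.ofReal b * A := by
  obtain ⟨t, C₀, ht, hC₀, hdist⟩ := hτ.exists_boundaryDist_le hn hΩ
  have hK : IsCompact (frontier Ω) :=
    Metric.isCompact_of_isClosed_isBounded isClosed_frontier
      (hΩ.isBounded.closure.subset frontier_subset_closure)
  choose! r hr C hC using fun x (hx : x ∈ frontier Ω) => hτ.exists_local_slices hn hΩ.isOpen hx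
  obtain ⟨I, hI, hcov⟩ := hK.elim_nhds_subcover (fun x => Metric.ball x (r x))
    fun x hx => Metric.ball_mem_nhds x (hr x hx)
  have hopen : IsOpen (⋃ x ∈ I, Metric.ball x (r x)) :=
    isOpen_biUnion fun x _ => Metric.isOpen_ball
  obtain ⟨ε, hε, hεI⟩ := hK.exists_thickening_subset_open hopen hcov
  refine ⟨min t (ε / C₀), by positivity, (∑ x ∈ I, C x) * C₀.toNNReal, fun g A b hb hg hA => ?_⟩
  have hsub : {z | 0 < τ z ∧ τ z < b} ⊆ ⋃ x ∈ I,
      {z | z ∈ Ω ∩ Metric.ball x (r x) ∧ 0 < boundaryDist Ω z ∧ boundaryDist Ω z < C₀ * b} := by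
    rintro z ⟨hz0, hzb⟩
    have hz : z ∈ Ω := (hτ.mem_iff z).2 hz0
    have h1 := hdist z hz (hzb.trans_le (hb.trans (min_le_left _ _)))
    have h2 : C₀ * τ z < C₀ * b := mul_lt_mul_of_pos_left hzb hC₀
    have h3 : C₀ * b ≤ ε := by
      have := hb.trans (min_le_right _ _)
      rw [le_div_iff₀ hC₀] at this
      linarith
    have hzf : z ∉ frontier Ω := fun h => by rw [hΩ.isOpen.frontier_eq] at h; exact h.2 hz
    have hδ0 : 0 < boundaryDist Ω z :=
      (isClosed_frontier.notMem_iff_infDist_pos (hΩ.frontier_nonempty hn)).1 hzf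
    have hmem : z ∈ Metric.thickening ε (frontier Ω) := by
      rw [Metric.mem_thickening_iff_infDist_lt (hΩ.frontier_nonempty hn)]
      exact lt_of_lt_of_le (h1.trans_lt h2) h3
    obtain ⟨x, hxI, hx⟩ := Set.mem_iUnion₂.1 (hεI hmem)
    exact Set.mem_iUnion₂.2 ⟨x, hxI, ⟨hz, hx⟩, hδ0, h1.trans_lt h2⟩
  calc _ ≤ ∫⁻ z in ⋃ x ∈ I, {z | z ∈ Ω ∩ Metric.ball x (r x) ∧ 0 < boundaryDist Ω z ∧
          boundaryDist Ω z < C₀ * b}, g z := lintegral_mono_set hsub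
    _ ≤ ∑ x ∈ I, ∫⁻ z in {z | z ∈ Ω ∩ Metric.ball x (r x) ∧ 0 < boundaryDist Ω z ∧
          boundaryDist Ω z < C₀ * b}, g z := by
        exact setLIntegral_biUnion_finset_le _ _ _ _
    _ ≤ ∑ x ∈ I, (C x : ℝ≥0∞) * ENNReal.ofReal (C₀ * b) * A :=
        Finset.sum_le_sum fun x hx => hC x (hI x hx) g A (C₀ * b) hg hA
    _ = _ := by
        rw [← Finset.sum_mul, ← Finset.sum_mul, ENNReal.ofReal_mul hC₀.le]
        push_cast
        simp only [ENNReal.ofReal]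
        ring

/-! ### Weighted sup bound and weak-type estimate -/

theorem IsDefiningFunction.exists_norm_le_on_level {n : ℕ} (hn : 1 ≤ n) {Ω : Set (CSpace n)}
    (hΩ : IsBoundedDomain Ω) {τ : CSpace n → ℝ} (hτ : IsDefiningFunction Ω τ) {f : CSpace n → ℂ}
    (hf : DifferentiableOn ℂ f Ω) {t : ℝ} (ht : 0 < t) {z : CSpace n} (hz : t ≤ τ z) :
    ∃ z' ∈ Ω, τ z' = t ∧ ‖f z‖ ≤ ‖f z'‖ := by
  have hτc := hτ.contDiff.continuous
  rcases hz.eq_or_lt with h | h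
  · exact ⟨z, (hτ.mem_iff z).2 (by linarith), h.symm, le_rfl⟩
  have : Nontrivial (CSpace n) :=
    ⟨⟨EuclideanSpace.single ⟨0, hn⟩ 1, 0, fun h0 => by
      have := congrArg (fun v : CSpace n => v ⟨0, hn⟩) h0
      simp at this⟩⟩
  set U : Set (CSpace n) := {y | t < τ y} with hU
  have hUo : IsOpen U := isOpen_lt continuous_const hτc
  have hcl : closure U ⊆ {y | t ≤ τ y} :=
    closure_minimal (fun y (hy : t < τ y) => hy.le) (isClosed_le continuous_const hτc)
  have hclΩ : closure U ⊆ Ω := fun y hy => (hτ.mem_iff y).2 (ht.trans_le (hcl hy))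
  have hUb : Bornology.IsBounded U := hΩ.isBounded.subset (subset_closure.trans hclΩ)
  obtain ⟨z', hz', hmax⟩ := Complex.exists_mem_frontier_isMaxOn_norm hUb ⟨z, h⟩
    (hf.mono hclΩ).diffContOnCl
  have hz'c := frontier_subset_closure hz'
  refine ⟨z', hclΩ hz'c, le_antisymm ?_ (hcl hz'c), hmax (subset_closure h)⟩
  rw [hUo.frontier_eq] at hz'
  exact not_lt.1 hz'.2

/-- Near the boundary the mass of the shell of thickness 2τ(z) is at most a multiple of τ(z)B, which
cancels one power of τ in the pointwise bound. Deeper points are moved by the maximum principle to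
the level τ = β/2; the factor Q^n pays for the change of weight. -/
theorem exists_weighted_sup_bound {n : ℕ} (hn : 1 ≤ n) {Ω : Set (CSpace n)}
    (hΩ : IsBoundedDomain Ω) {τ : CSpace n → ℝ} (hτ : IsDefiningFunction Ω τ) {β C₁ : ℝ}
    (hβ : 0 < β) (hC₁ : 0 < C₁) : ∃ C : ℝ, 0 < C ∧ ∀ f : CSpace n → ℂ, DifferentiableOn ℂ f Ω →
      ∀ s l B : ℝ, 0 < s → 0 ≤ B →
      (∀ b, 0 < b → b ≤ β →
        shellMass τ (fun z => max (‖f z‖ ^ s - l) 0) b ≤ ENNReal.ofReal (C₁ * b * B)) →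
      ∀ z ∈ Ω, τ z ^ n * max (‖f z‖ ^ s - l) 0 ≤ C * B := by
  obtain ⟨C₂, hC₂, hpt⟩ := exists_pointwise_bound hn hΩ hτ
  obtain ⟨T, hT⟩ := hτ.contDiff.continuous.bounded_above_of_compact_support hτ.hasCompactSupport
  have hT0 : 0 ≤ T := (norm_nonneg _).trans (hT 0)
  set Q := max 1 (2 * T / β) with hQ
  have hQ1 : 1 ≤ Q := le_max_left _ _
  refine ⟨2 * C₁ * C₂ * Q ^ n, by positivity, fun f hf s l B hs hB hmass => ?_⟩
  set w : CSpace n → ℝ := fun z => max (‖f z‖ ^ s - l) 0 with hw_def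
  have hw : DiscSubmean Ω w := discSubmean_norm_rpow_sub hΩ.isOpen hf hs l
  have hnear : ∀ z ∈ Ω, τ z ≤ β / 2 → τ z ^ n * w z ≤ 2 * C₁ * C₂ * B := by
    intro z hz hzβ
    have hz0 := (hτ.mem_iff z).1 hz
    have h1 := (hpt w hw z hz).trans
      (mul_le_mul_right (hmass (2 * τ z) (by positivity) (by linarith)) _)
    rw [← ENNReal.ofReal_mul (by positivity), ← ENNReal.ofReal_mul hC₂.le,
      ENNReal.ofReal_le_ofReal_iff (by positivity)] at h1
    have e1 : τ z ^ (n + 1) * w z = τ z * (τ z ^ n * w z) := by ring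
    have e2 : C₂ * (C₁ * (2 * τ z) * B) = τ z * (2 * C₁ * C₂ * B) := by ring
    rw [e1, e2] at h1
    exact le_of_mul_le_mul_left h1 hz0
  intro z hz
  have hQn : 1 ≤ Q ^ n := one_le_pow₀ hQ1
  have hK0 : 0 ≤ 2 * C₁ * C₂ * B := by positivity
  rcases le_total (τ z) (β / 2) with h | h
  · refine (hnear z hz h).trans ?_
    nlinarith
  · obtain ⟨z', hz', hz't, hle⟩ := hτ.exists_norm_le_on_level hn hΩ hf (half_pos hβ) h
    have h1 := hnear z' hz' hz't.le
    have h2 : w z ≤ w z' := by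
      simp only [hw_def]
      gcongr
    have h3 : τ z ≤ Q * τ z' := by
      have h4 : 2 * T / β ≤ Q := le_max_right _ _
      rw [div_le_iff₀ hβ] at h4
      have := (le_abs_self _).trans (hT z)
      rw [hz't]; linarith
    have hz0 := (hτ.mem_iff z).1 hz
    calc τ z ^ n * w z ≤ (Q * τ z') ^ n * w z' := by
          apply mul_le_mul _ h2 (hw.nonneg z) (by rw [hz't]; positivity)
          exact pow_le_pow_left₀ hz0.le h3 n
      _ = Q ^ n * (τ z' ^ n * w z') := by ring
      _ ≤ Q ^ n * (2 * C₁ * C₂ * B) := by gcongr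
      _ = _ := by ring

/-- The sup bound confines {w > l} to a shell of thickness b of order (B/l)^(1/n). Chebyshev's
inequality with the mass bound C₁bB supplies the remaining factor B/l. -/
theorem exists_weak_type_bound {n : ℕ} (hn : 1 ≤ n) {Ω : Set (CSpace n)}
    (hΩ : IsBoundedDomain Ω) {τ : CSpace n → ℝ} (hτ : IsDefiningFunction Ω τ) {β C₁ : ℝ}
    (hβ : 0 < β) (hC₁ : 0 < C₁) : ∃ C : ℝ≥0, ∀ f : CSpace n → ℂ, DifferentiableOn ℂ f Ω →
      ∀ s l B : ℝ, 0 < s → 0 < l → 0 ≤ B →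
      (∀ b, 0 < b → b ≤ β →
        shellMass τ (fun z => max (‖f z‖ ^ s - l) 0) b ≤ ENNReal.ofReal (C₁ * b * B)) →
      volume {z | z ∈ Ω ∧ l < max (‖f z‖ ^ s - l) 0} ≤
        C * ENNReal.ofReal ((B / l) ^ (1 + 1 / (n : ℝ))) := by
  obtain ⟨C₅, hC₅, hsup⟩ := exists_weighted_sup_bound hn hΩ hτ hβ hC₁
  have hn' : (0 : ℝ) < n := by exact_mod_cast hn
  have hvol : volume Ω ≠ ⊤ := hΩ.isBounded.measure_lt_top.ne
  set D₁ : ℝ := C₁ * (2 * C₅ ^ (1 / (n : ℝ))) with hD₁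
  set D₂ : ℝ := (volume Ω).toReal * (C₅ * (2 / β) ^ n) ^ (1 + 1 / (n : ℝ)) with hD₂
  have hD₁0 : 0 ≤ D₁ := by positivity
  have hD₂0 : 0 ≤ D₂ := by positivity
  refine ⟨(D₁ + D₂).toNNReal, fun f hf s l B hs hl hB hmass => ?_⟩
  change _ ≤ ENNReal.ofReal (D₁ + D₂) * _
  rw [← ENNReal.ofReal_mul (by positivity)]
  have hpt := hsup f hf s l B hs hB hmass
  set w : CSpace n → ℝ := fun z => max (‖f z‖ ^ s - l) 0 with hw_def
  have hw : DiscSubmean Ω w := discSubmean_norm_rpow_sub hΩ.isOpen hf hs l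
  set X := B / l with hX
  have hX0 : 0 ≤ X := by positivity
  have hτX : ∀ z ∈ Ω, l < w z → τ z ^ n ≤ C₅ * X := by
    intro z hz hlw
    have h1 := hpt z hz
    have h0 := (hτ.mem_iff z).1 hz
    have h2 : τ z ^ n * l ≤ C₅ * B := (mul_le_mul_of_nonneg_left hlw.le (by positivity)).trans h1
    rw [hX, ← mul_div_assoc, le_div_iff₀ hl]
    exact h2
  have hpow : 0 ≤ X ^ (1 + 1 / (n : ℝ)) := by positivity
  rcases hX0.eq_or_lt with h0 | hXpos
  · have : {z | z ∈ Ω ∧ l < w z} = ∅ := by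
      refine Set.eq_empty_of_forall_notMem fun z hz => ?_
      have h1 := hτX z hz.1 hz.2
      have h2 := pow_pos ((hτ.mem_iff z).1 hz.1) n
      rw [← h0, mul_zero] at h1
      linarith
    rw [this]
    simp
  -- The factor 2 gives the strict inequality τ < b.
  set b := 2 * (C₅ * X) ^ (1 / (n : ℝ)) with hb
  have hb0 : 0 < b := by positivity
  have hτb : ∀ z ∈ Ω, l < w z → τ z < b := by
    intro z hz hlw
    have h1 := hτX z hz hlw
    have h2 := (hτ.mem_iff z).1 hz
    have h3 : τ z ≤ (C₅ * X) ^ (1 / (n : ℝ)) := by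
      calc τ z = (τ z ^ n) ^ (1 / (n : ℝ)) := by
            rw [one_div, Real.pow_rpow_inv_natCast h2.le (by omega)]
        _ ≤ _ := by gcongr
    have h4 : 0 < (C₅ * X) ^ (1 / (n : ℝ)) := by positivity
    linarith
  rcases le_or_gt b β with hbβ | hbβ
  · have hm : MeasurableSet {z | z ∈ Ω ∧ l < w z} := by
      have : {z | z ∈ Ω ∧ l < w z} = Ω ∩ w ⁻¹' Set.Ioi l := rfl
      rw [this]
      exact (hw.continuousOn.isOpen_inter_preimage hΩ.isOpen isOpen_Ioi).measurableSet
    have hcheb : ENNReal.ofReal l * volume {z | z ∈ Ω ∧ l < w z} ≤ shellMass τ w b := by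
      rw [← setLIntegral_const]
      calc ∫⁻ _ in {z | z ∈ Ω ∧ l < w z}, ENNReal.ofReal l
          ≤ ∫⁻ z in {z | z ∈ Ω ∧ l < w z}, ENNReal.ofReal (w z) :=
            setLIntegral_mono' hm fun z hz => ENNReal.ofReal_le_ofReal hz.2.le
        _ ≤ shellMass τ w b := by
          refine lintegral_mono_set fun z hz => ?_
          exact ⟨(hτ.mem_iff z).1 hz.1, hτb z hz.1 hz.2⟩
    have h1 := hcheb.trans (hmass b hb0 hbβ)
    have hl' : ENNReal.ofReal l ≠ 0 := by simpa using hl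
    have e : C₁ * b * B = l * (D₁ * X ^ (1 + 1 / (n : ℝ))) := by
      rw [hb, hD₁, Real.mul_rpow hC₅.le hX0, Real.rpow_add hXpos, Real.rpow_one]
      have : B = l * X := by rw [hX]; field_simp
      rw [this]; ring
    rw [e, ENNReal.ofReal_mul hl.le, ENNReal.mul_le_mul_iff_right hl' ENNReal.ofReal_ne_top] at h1
    refine h1.trans (ENNReal.ofReal_le_ofReal ?_)
    nlinarith
  -- If b exceeds β, then B/l is bounded below and the finite volume of Ω suffices.
  · have h1 : 1 ≤ C₅ * (2 / β) ^ n * X := by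
      have h2 : β / 2 < (C₅ * X) ^ (1 / (n : ℝ)) := by linarith
      have h3 : (β / 2) ^ n ≤ C₅ * X := by
        calc (β / 2) ^ n ≤ ((C₅ * X) ^ (1 / (n : ℝ))) ^ n := by gcongr
          _ = _ := by rw [one_div, Real.rpow_inv_natCast_pow (by positivity) (by omega)]
      have h4 : (2 / β) ^ n * (β / 2) ^ n = 1 := by
        rw [← mul_pow]; field_simp; simp
      calc (1 : ℝ) = (2 / β) ^ n * (β / 2) ^ n := h4.symm
        _ ≤ (2 / β) ^ n * (C₅ * X) := by gcongr
        _ = _ := by ring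
    have h5 : (1 : ℝ) ≤ (C₅ * (2 / β) ^ n) ^ (1 + 1 / (n : ℝ)) * X ^ (1 + 1 / (n : ℝ)) := by
      rw [← Real.mul_rpow (by positivity) hX0]
      exact Real.one_le_rpow h1 (by positivity)
    calc volume {z | z ∈ Ω ∧ l < w z} ≤ volume Ω := measure_mono fun z hz => hz.1
      _ = ENNReal.ofReal (volume Ω).toReal := (ENNReal.ofReal_toReal hvol).symm
      _ ≤ _ := by
        refine ENNReal.ofReal_le_ofReal ?_
        have h6 : (volume Ω).toReal * 1 ≤ (volume Ω).toReal *
          ((C₅ * (2 / β) ^ n) ^ (1 + 1 / (n : ℝ)) * X ^ (1 + 1 / (n : ℝ))) := by gcongr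
        have h7 : 0 ≤ D₁ * X ^ (1 + 1 / (n : ℝ)) := by positivity
        have h8 : D₂ * X ^ (1 + 1 / (n : ℝ)) = (volume Ω).toReal *
          ((C₅ * (2 / β) ^ n) ^ (1 + 1 / (n : ℝ)) * X ^ (1 + 1 / (n : ℝ))) := by rw [hD₂]; ring
        linarith

/-! ### Strong-type estimate by truncation at all levels -/

theorem lintegral_posPart_sub_le (v : ℝ) :
    ∫⁻ l in Set.Ioi (0 : ℝ), ENNReal.ofReal (max (v - l) 0) ≤ ENNReal.ofReal (v ^ 2) := by
  rcases le_or_gt v 0 with hv | hv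
  · refine le_trans (le_of_eq ?_) (zero_le (a := _))
    rw [setLIntegral_congr_fun (g := fun _ => 0) measurableSet_Ioi fun l hl => ?_, lintegral_zero]
    have hl : 0 < l := hl
    simp only
    rw [max_eq_right (by linarith), ENNReal.ofReal_zero]
  calc ∫⁻ l in Set.Ioi (0 : ℝ), ENNReal.ofReal (max (v - l) 0)
      ≤ ∫⁻ l in Set.Ioi (0 : ℝ), (Set.Iio v).indicator (fun _ => ENNReal.ofReal v) l := by
        refine setLIntegral_mono' measurableSet_Ioi fun l hl => ?_
        have hl : 0 < l := hl
        by_cases h : l < v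
        · rw [Set.indicator_of_mem (show l ∈ Set.Iio v from h)]
          exact ENNReal.ofReal_le_ofReal (max_le (by linarith) hv.le)
        · rw [max_eq_right (by linarith), ENNReal.ofReal_zero]
          exact zero_le
    _ = ENNReal.ofReal (v ^ 2) := by
        rw [lintegral_indicator measurableSet_Iio, Measure.restrict_restrict measurableSet_Iio,
          Set.Iio_inter_Ioi, setLIntegral_const, Real.volume_Ioo, sub_zero,
          ← ENNReal.ofReal_mul hv.le, sq]

theorem exists_lintegral_rpow_le {n : ℕ} (hn : 1 ≤ n) {Ω : Set (CSpace n)}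
    (hΩ : IsBoundedDomain Ω) (hbd : HasC2Boundary Ω) {p q : ℝ} (hp : 0 < p)
    (hq : q = p * (1 + 1 / (n : ℝ))) : ∃ C : ℝ≥0, ∀ f : CSpace n → ℂ, DifferentiableOn ℂ f Ω →
      Measurable f → ∀ A : ℝ≥0∞, A ≠ ⊤ →
      (∀ ε > 0, ∫⁻ z in {z | z ∈ Ω ∧ boundaryDist Ω z = ε}, ‖f z‖ₑ ^ p ∂μHE[2 * n - 1] ≤ A) →
      ∫⁻ z in Ω, ‖f z‖ₑ ^ q ≤ C * A ^ (1 + 1 / (n : ℝ)) := by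
  obtain ⟨τ, hτ₁, hτ₂, hτ₃, hτ₄⟩ := exists_defining_function hΩ hbd
  have hτ : IsDefiningFunction Ω τ := ⟨hτ₁, hτ₂, hτ₃, hτ₄⟩
  obtain ⟨c₀, C₁, hc₀, hC₁, hcomp⟩ := exists_shellMass_comparison hΩ hτ
  obtain ⟨b₀, hb₀, C₃, hslice⟩ := hτ.exists_shell_le_slices hn hΩ
  set β := min c₀ b₀ with hβ_def
  have hβ : 0 < β := by positivity
  obtain ⟨C₄, hweak⟩ := exists_weak_type_bound hn hΩ hτ hβ hC₁
  have hn' : (0 : ℝ) < n := by exact_mod_cast hn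
  -- With v = |f|^(p/2), this exponent gives v^s = |f|^q.
  set s : ℝ := 2 + 2 / (n : ℝ) with hs
  have hs0 : 0 < s := by positivity
  refine ⟨2 ^ s * s.toNNReal * C₄ * C₃ ^ (1 + 1 / (n : ℝ)), fun f hf hfm A hA hfA => ?_⟩
  have hp2 : 0 < p / 2 := by positivity
  set v : CSpace n → ℝ := fun z => ‖f z‖ ^ (p / 2) with hv
  have hv0 : ∀ z, 0 ≤ v z := fun z => by positivity
  have hvm : Measurable v := hfm.norm.pow_const _
  have hvp : ∀ z, ENNReal.ofReal (v z ^ 2) = ‖f z‖ₑ ^ p := fun z => by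
    rw [← ofReal_norm, ENNReal.ofReal_rpow_of_nonneg (norm_nonneg _) hp.le, hv]
    congr 1
    simp only
    rw [← Real.rpow_natCast, ← Real.rpow_mul (norm_nonneg _)]
    norm_num
  set w : ℝ → CSpace n → ℝ := fun l z => max (v z - l) 0 with hw_def
  have hw : ∀ l, DiscSubmean Ω (w l) := fun l => discSubmean_norm_rpow_sub hΩ.isOpen hf hp2 l
  have hE : ∀ b, b ≤ β → ∫⁻ z in {z | 0 < τ z ∧ τ z < b}, ENNReal.ofReal (v z ^ 2) ≤
      C₃ * ENNReal.ofReal b * A := fun b hb => by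
    simp only [hvp]
    exact hslice (fun z => ‖f z‖ₑ ^ p) A b (hb.trans (min_le_right _ _)) (hfm.enorm.pow_const _) hfA
  set a : ℕ → ℝ := fun k => β * (1 / ((k : ℝ) + 1)) with ha_def
  have ha0 : ∀ k, 0 < a k := fun k => by positivity
  have haβ : ∀ k, a k ≤ β := fun k => by
    have : 1 / ((k : ℝ) + 1) ≤ 1 := by
      rw [div_le_one (by positivity)]
      have : (0 : ℝ) ≤ k := by positivity
      linarith
    nlinarith
  have ha_lim : Filter.Tendsto a Filter.atTop (𝓝 0) := by
    have := (tendsto_one_div_add_atTop_nhds_zero_nat (𝕜 := ℝ)).const_mul β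
    rw [mul_zero] at this
    exact this
  have ha_ne : ∀ k, ENNReal.ofReal (a k) ≠ 0 := fun k => by simpa using ha0 k
  -- A lower limit suits both uses: Fatou's lemma bounds its integral over l, and the shell
  -- comparison as a_k → 0 makes it control every thicker shell.
  set B : ℝ → ℝ≥0∞ := fun l =>
    Filter.liminf (fun k => shellMass τ (w l) (a k) / ENNReal.ofReal (a k)) Filter.atTop with hB
  have hunc : Measurable (Function.uncurry fun (l : ℝ) (z : CSpace n) => ENNReal.ofReal (w l z)) := by
    have : Measurable fun x : ℝ × CSpace n => max (v x.2 - x.1) 0 :=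
      ((hvm.comp measurable_snd).sub measurable_fst).max measurable_const
    exact this.ennreal_ofReal
  have hSm : ∀ b, Measurable fun l => shellMass τ (w l) b := fun b => hunc.lintegral_prod_right
  have hBint : ∫⁻ l in Set.Ioi 0, B l ≤ C₃ * A := by
    refine (lintegral_liminf_le fun k => (hSm (a k)).div_const _).trans ?_
    refine (Filter.liminf_le_liminf (Filter.Eventually.of_forall fun k => ?_)).trans
      (Filter.liminf_const (C₃ * A)).le
    simp only [div_eq_mul_inv]
    rw [lintegral_mul_const _ (hSm (a k)), ← div_eq_mul_inv]
    refine ENNReal.div_le_of_le_mul ?_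
    calc ∫⁻ l in Set.Ioi 0, shellMass τ (w l) (a k)
        = ∫⁻ z in {z | 0 < τ z ∧ τ z < a k}, ∫⁻ l in Set.Ioi 0, ENNReal.ofReal (w l z) :=
          lintegral_lintegral_swap hunc.aemeasurable
      _ ≤ ∫⁻ z in {z | 0 < τ z ∧ τ z < a k}, ENNReal.ofReal (v z ^ 2) :=
          lintegral_mono fun z => lintegral_posPart_sub_le (v z)
      _ ≤ C₃ * ENNReal.ofReal (a k) * A := hE _ (haβ k)
      _ = _ := by ring
  have hBl : ∀ l, 0 < l → ENNReal.ofReal l * B l ≤ C₃ * A := by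
    intro l hl
    have hl' : ENNReal.ofReal l ≠ 0 := by simpa using hl
    have h1 : B l ≤ C₃ * A / ENNReal.ofReal l := by
      refine (Filter.liminf_le_liminf (Filter.Eventually.of_forall fun k => ?_)).trans
        (Filter.liminf_const (C₃ * A / ENNReal.ofReal l)).le
      refine ENNReal.div_le_of_le_mul ?_
      rw [← ENNReal.mul_div_right_comm, ENNReal.le_div_iff_mul_le (Or.inl hl')
        (Or.inl ENNReal.ofReal_ne_top), mul_comm, shellMass,
        ← lintegral_const_mul' _ _ ENNReal.ofReal_ne_top]
      calc _ ≤ ∫⁻ z in {z | 0 < τ z ∧ τ z < a k}, ENNReal.ofReal (v z ^ 2) := by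
            refine lintegral_mono fun z => ?_
            rw [← ENNReal.ofReal_mul hl.le]
            refine ENNReal.ofReal_le_ofReal ?_
            simp only [hw_def]
            rcases le_total (v z) l with h | h
            · rw [max_eq_right (by linarith), mul_zero]; positivity
            · rw [max_eq_left (by linarith)]; nlinarith [hv0 z]
        _ ≤ C₃ * ENNReal.ofReal (a k) * A := hE _ (haβ k)
        _ = _ := by ring
    calc ENNReal.ofReal l * B l ≤ ENNReal.ofReal l * (C₃ * A / ENNReal.ofReal l) := by gcongr
      _ = C₃ * A := ENNReal.mul_div_cancel hl' ENNReal.ofReal_ne_top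
  have hCA : (C₃ : ℝ≥0∞) * A ≠ ⊤ := ENNReal.mul_ne_top ENNReal.coe_ne_top hA
  have hBtop : ∀ l, 0 < l → B l ≠ ⊤ := fun l hl h => by
    have h1 := hBl l hl
    rw [h, ENNReal.mul_top (by simpa using hl)] at h1
    exact hCA (top_le_iff.1 h1)
  have hmass : ∀ l, 0 < l → ∀ b, 0 < b → b ≤ β →
      shellMass τ (w l) b ≤ ENNReal.ofReal (C₁ * b * (B l).toReal) := by
    intro l hl b hb hbβ
    have hCb : ENNReal.ofReal (C₁ * b) ≠ 0 := by simpa using mul_pos hC₁ hb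
    rw [ENNReal.ofReal_mul (by positivity), ENNReal.ofReal_toReal (hBtop l hl), mul_comm]
    rw [← ENNReal.div_le_iff hCb ENNReal.ofReal_ne_top]
    refine Filter.le_liminf_of_le (by isBoundedDefault) ?_
    filter_upwards [ha_lim.eventually_le_const hb] with k hk
    have h1 := hcomp (w l) (hw l) (a k) b (ha0 k) hk (hbβ.trans (min_le_left _ _))
    rw [ENNReal.div_le_iff hCb ENNReal.ofReal_ne_top,
      ← ENNReal.mul_div_right_comm, ENNReal.le_div_iff_mul_le (Or.inl (ha_ne k))
        (Or.inl ENNReal.ofReal_ne_top), mul_comm, mul_comm (shellMass τ (w l) (a k))]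
    exact h1
  -- Since s - 1 - (1 + 1/n) = 1/n, the weak-type bound times l^(s-1) is (l B)^(1/n) B. The first
  -- factor is bounded uniformly in l and the second is integrable.
  have hlevel : ∀ l, 0 < l → (volume.restrict Ω) {z | l < v z / 2} * ENNReal.ofReal (l ^ (s - 1)) ≤
      C₄ * (C₃ * A) ^ (1 / (n : ℝ)) * B l := by
    intro l hl
    have h1 := hweak f hf (p / 2) l (B l).toReal hp2 hl ENNReal.toReal_nonneg (hmass l hl)
    have h2 : (volume.restrict Ω) {z | l < v z / 2} ≤
        volume {z | z ∈ Ω ∧ l < max (‖f z‖ ^ (p / 2) - l) 0} := by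
      rw [Measure.restrict_apply (measurableSet_lt measurable_const (hvm.div_const 2))]
      refine measure_mono fun z hz => ⟨hz.2, lt_max_of_lt_left ?_⟩
      have : l < v z / 2 := hz.1
      simp only [hv] at this
      linarith
    have e1 : ((B l).toReal / l) ^ (1 + 1 / (n : ℝ)) * l ^ (s - 1) =
        (l * (B l).toReal) ^ (1 / (n : ℝ)) * (B l).toReal := by
      have hB0 : 0 ≤ (B l).toReal := ENNReal.toReal_nonneg
      rw [Real.div_rpow hB0 hl.le, Real.mul_rpow hl.le hB0, div_mul_eq_mul_div, mul_div_assoc,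
        ← Real.rpow_sub hl, Real.rpow_add' hB0 (by positivity), Real.rpow_one]
      have : s - 1 - (1 + 1 / (n : ℝ)) = 1 / (n : ℝ) := by rw [hs]; ring
      rw [this]; ring
    calc _ ≤ C₄ * ENNReal.ofReal (((B l).toReal / l) ^ (1 + 1 / (n : ℝ))) *
          ENNReal.ofReal (l ^ (s - 1)) := by gcongr; exact h2.trans h1
      _ = C₄ * ((ENNReal.ofReal l * B l) ^ (1 / (n : ℝ)) * B l) := by
          rw [mul_assoc, ← ENNReal.ofReal_mul (by positivity), e1, ENNReal.ofReal_mul (by positivity),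
            ← ENNReal.ofReal_rpow_of_nonneg (by positivity) (by positivity),
            ENNReal.ofReal_mul hl.le, ENNReal.ofReal_toReal (hBtop l hl)]
      _ ≤ C₄ * ((C₃ * A) ^ (1 / (n : ℝ)) * B l) := by
          have h3 := ENNReal.rpow_le_rpow (hBl l hl) (show 0 ≤ 1 / (n : ℝ) by positivity)
          exact mul_le_mul' le_rfl (mul_le_mul' h3 le_rfl)
      _ = _ := by ring
  -- The layer-cake formula is applied to v/2 because (v - l)_+ > l means v > 2l.
  have hlayer := lintegral_rpow_eq_lintegral_meas_lt_mul (volume.restrict Ω) (f := fun z => v z / 2)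
    (ae_of_all _ fun z => by have := hv0 z; simp only [Pi.zero_apply]; positivity)
    (hvm.div_const 2).aemeasurable hs0
  have hfin : ∫⁻ z in Ω, ENNReal.ofReal ((v z / 2) ^ s) ≤
      ENNReal.ofReal s * (C₄ * (C₃ * A) ^ (1 / (n : ℝ)) * (C₃ * A)) := by
    rw [hlayer]
    gcongr
    calc _ ≤ ∫⁻ l in Set.Ioi 0, C₄ * (C₃ * A) ^ (1 / (n : ℝ)) * B l :=
          setLIntegral_mono' measurableSet_Ioi fun l hl => hlevel l hl
      _ = C₄ * (C₃ * A) ^ (1 / (n : ℝ)) * ∫⁻ l in Set.Ioi 0, B l := by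
          refine lintegral_const_mul' _ _ (ENNReal.mul_ne_top ENNReal.coe_ne_top ?_)
          exact (ENNReal.rpow_lt_top_of_nonneg (by positivity) hCA).ne
      _ ≤ _ := by gcongr
  have hfq : ∀ z, ‖f z‖ₑ ^ q = 2 ^ s * ENNReal.ofReal ((v z / 2) ^ s) := fun z => by
    have h1 : v z ^ s = ‖f z‖ ^ q := by
      rw [hv, ← Real.rpow_mul (norm_nonneg _)]
      congr 1
      rw [hs, hq]; ring
    have hq0 : 0 ≤ q := by rw [hq]; positivity
    have h2 : (2 : ℝ≥0∞) ^ s = ENNReal.ofReal (2 ^ s) := by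
      rw [← ENNReal.ofReal_rpow_of_pos (by norm_num), ENNReal.ofReal_ofNat]
    rw [h2, ← ENNReal.ofReal_mul (by positivity), ← Real.mul_rpow (by norm_num)
      (by have := hv0 z; positivity), mul_div_cancel₀ _ (by norm_num : (2 : ℝ) ≠ 0), h1,
      ← ofReal_norm, ENNReal.ofReal_rpow_of_nonneg (norm_nonneg _) hq0]
  simp only [hfq]
  rw [lintegral_const_mul' _ _ (ENNReal.rpow_ne_top_of_nonneg hs0.le (by norm_num))]
  calc _ ≤ 2 ^ s * (ENNReal.ofReal s * (C₄ * (C₃ * A) ^ (1 / (n : ℝ)) * (C₃ * A))) := by gcongr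
    _ = 2 ^ s * ENNReal.ofReal s * C₄ * (C₃ * A) ^ (1 + 1 / (n : ℝ)) := by
        rw [ENNReal.rpow_add_of_nonneg _ _ zero_le_one (by positivity), ENNReal.rpow_one]
        ring
    _ = _ := by
        rw [ENNReal.mul_rpow_of_nonneg _ _ (by positivity)]
        push_cast
        rw [ENNReal.coe_rpow_of_nonneg _ hs0.le, ENNReal.coe_rpow_of_nonneg C₃ (by positivity)]
        simp only [ENNReal.ofReal, ENNReal.coe_ofNat]
        ring

/-! ### Norm inequality and comparison of kernels -/

theorem exists_bergmanNorm_le_hardyNorm {n : ℕ} (hn : 1 ≤ n) {Ω : Set (CSpace n)}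
    (hΩ : IsBoundedDomain Ω) (hbd : HasC2Boundary Ω) {p q : ℝ} (hp : 0 < p)
    (hq : q = p * (1 + 1 / (n : ℝ))) : ∃ C : ℝ≥0, ∀ f ∈ hardySpace Ω p,
      f ∈ bergmanSpace Ω q ∧ bergmanNorm Ω q f ≤ C * hardyNorm Ω p f := by
  obtain ⟨C, hC⟩ := exists_lintegral_rpow_le hn hΩ hbd hp hq
  have hn' : (0 : ℝ) < n := by exact_mod_cast hn
  have hq0 : 0 < q := by rw [hq]; positivity
  refine ⟨C ^ (1 / q), fun f hf => ?_⟩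
  have hle : bergmanNorm Ω q f ≤ (C ^ (1 / q) : ℝ≥0) * hardyNorm Ω p f := by
    set A : ℝ≥0∞ := ⨆ (ε : ℝ) (_ : 0 < ε),
      ∫⁻ z in {z | z ∈ Ω ∧ boundaryDist Ω z = ε}, ‖f z‖ₑ ^ p ∂μHE[2 * n - 1] with hA
    have hAtop : A ≠ ⊤ := by
      intro h
      have : hardyNorm Ω p f = A ^ (1 / p) := rfl
      have h2 := hf.2
      rw [this, h, ENNReal.top_rpow_of_pos (by positivity)] at h2
      exact lt_irrefl _ h2
    -- The values of f outside Ω are arbitrary; extension by zero makes it measurable on the whole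
    -- space.
    set g : CSpace n → ℂ := Ω.indicator f with hg
    have hgf : Set.EqOn g f Ω := fun z hz => Set.indicator_of_mem hz f
    have hgm : Measurable g := by
      classical
      rw [hg, ← Set.piecewise_eq_indicator]
      exact hf.1.continuousOn.measurable_piecewise continuousOn_const hΩ.isOpen.measurableSet
    have hgA : ∀ ε > 0, ∫⁻ z in {z | z ∈ Ω ∧ boundaryDist Ω z = ε}, ‖g z‖ₑ ^ p ∂μHE[2 * n - 1] ≤ A := by
      intro ε hε
      refine le_trans (le_of_eq ?_) (le_iSup₂ (f := fun (ε : ℝ) (_ : 0 < ε) =>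
        ∫⁻ z in {z | z ∈ Ω ∧ boundaryDist Ω z = ε}, ‖f z‖ₑ ^ p ∂μHE[2 * n - 1]) ε hε)
      have hm : MeasurableSet {z | z ∈ Ω ∧ boundaryDist Ω z = ε} :=
        hΩ.isOpen.measurableSet.inter (isClosed_eq (lipschitzWith_boundaryDist Ω).continuous
          continuous_const).measurableSet
      exact setLIntegral_congr_fun hm fun z hz => by simp only [hgf hz.1]
    have h1 := hC g (hf.1.congr hgf) hgm A hAtop hgA
    have h2 : ∫⁻ z in Ω, ‖g z‖ₑ ^ q = ∫⁻ z in Ω, ‖f z‖ₑ ^ q :=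
      setLIntegral_congr_fun hΩ.isOpen.measurableSet fun z hz => by simp only [hgf hz]
    rw [h2] at h1
    calc bergmanNorm Ω q f ≤ (C * A ^ (1 + 1 / (n : ℝ))) ^ (1 / q) :=
          ENNReal.rpow_le_rpow h1 (by positivity)
      _ = (C : ℝ≥0∞) ^ (1 / q) * A ^ (1 / p) := by
          rw [ENNReal.mul_rpow_of_nonneg _ _ (by positivity), ← ENNReal.rpow_mul]
          congr 2
          rw [hq]
          field_simp
      _ = _ := by
          rw [ENNReal.coe_rpow_of_nonneg _ (by positivity)]
          rfl
  exact ⟨⟨hf.1, hle.trans_lt (ENNReal.mul_lt_top ENNReal.coe_lt_top hf.2)⟩, hle⟩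

theorem theorem1p7 (n : ℕ) (hn : 1 ≤ n) (Ω : Set (CSpace n)) (hΩ : IsBoundedDomain Ω)
    (hbd : HasC2Boundary Ω) (p q : ℝ) (hp : 0 < p) (hq : q = p * (1 + 1 / (n : ℝ))) :
    (∃ C : ℝ≥0, ∀ f ∈ hardySpace Ω p,
      f ∈ bergmanSpace Ω q ∧ bergmanNorm Ω q f ≤ C * hardyNorm Ω p f) ∧
    (∃ C : ℝ≥0, ∀ z ∈ Ω,
      szegoKernel Ω p z ^ (1 / p) ≤ C * bergmanKernel Ω q z ^ (1 / q)) := by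
  obtain ⟨C, hC⟩ := exists_bergmanNorm_le_hardyNorm hn hΩ hbd hp hq
  have hn' : (0 : ℝ) < n := by exact_mod_cast hn
  have hq0 : 0 < q := by rw [hq]; positivity
  -- C may be 0; a positive constant avoids products of 0 and ∞ in the inversion at the end.
  refine ⟨⟨C, hC⟩, C + 1, fun z hz => ?_⟩
  have hker : bergmanKernel Ω q z ^ (1 / q) = (bergmanMin Ω q z)⁻¹ := by
    rw [bergmanKernel, ← ENNReal.rpow_mul, neg_mul, mul_one_div_cancel hq0.ne', ENNReal.rpow_neg_one]
  rw [hker, one_div, ENNReal.rpow_inv_le_iff hp]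
  refine iSup_le fun f => iSup₂_le fun hf hf1 => ?_
  refine ENNReal.rpow_le_rpow ?_ hp.le
  by_cases hfz : f z = 0
  · simp [hfz]
  have hfz' : ‖f z‖ₑ ≠ 0 := by simpa using hfz
  obtain ⟨hfA, hfle⟩ := hC f hf
  have hscale : bergmanNorm Ω q (fun y => f y / f z) = bergmanNorm Ω q f / ‖f z‖ₑ := by
    simp only [bergmanNorm, div_eq_mul_inv, enorm_mul, enorm_inv hfz]
    simp only [ENNReal.mul_rpow_of_nonneg _ _ hq0.le]
    rw [lintegral_mul_const', ENNReal.mul_rpow_of_nonneg _ _ (by positivity), ← ENNReal.rpow_mul,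
      one_mul, mul_inv_cancel₀ hq0.ne', ENNReal.rpow_one]
    exact ENNReal.rpow_ne_top_of_nonneg hq0.le (ENNReal.inv_ne_top.2 hfz')
  have hmem : (fun y => f y / f z) ∈ bergmanSpace Ω q := by
    refine ⟨by simpa only [div_eq_mul_inv] using hfA.1.mul_const (f z)⁻¹, ?_⟩
    rw [hscale]
    exact ENNReal.div_lt_top hfA.2.ne hfz'
  have hmin : bergmanMin Ω q z ≤ C / ‖f z‖ₑ := by
    refine (iInf₂_le_of_le _ hmem (iInf_le _ (div_self hfz))).trans ?_
    rw [hscale]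
    gcongr
    exact hfle.trans (mul_le_of_le_one_right zero_le hf1)
  have hmin' : bergmanMin Ω q z ≤ ((C + 1 : ℝ≥0) : ℝ≥0∞) / ‖f z‖ₑ :=
    hmin.trans (by gcongr; exact le_self_add)
  have hCpos : ((C + 1 : ℝ≥0) : ℝ≥0∞) ≠ 0 := by simp
  calc ‖f z‖ₑ = ((C + 1 : ℝ≥0) : ℝ≥0∞) * (((C + 1 : ℝ≥0) : ℝ≥0∞) / ‖f z‖ₑ)⁻¹ := by
        rw [ENNReal.inv_div (Or.inl enorm_ne_top) (Or.inl hfz'),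
          ENNReal.mul_div_cancel hCpos ENNReal.coe_ne_top]
    _ ≤ _ := by gcongr
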